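/- Let $\alpha\in\mathbb R$ and let $(M^{2n+1},g)$ be a smooth Riemannian manifold with an almost contact metric structure $(\phi,\xi,\eta,g)$, i.e. a smooth $(1,1)$-tensor $\phi$, a smooth vector field $\xi$ and a smooth $1$-form $\eta$ with $\phi^2=-I+\eta\otimes\xi$, $\eta(\xi)=1$ and $g(\phi X,\phi Y)=g(X,Y)-\eta(X)\eta(Y)$. Assume that the structure is almost $\alpha$-cosymplectic: $d\eta=0$ and $d\Phi=2\alpha\,\eta\wedge\Phi$, where $\Phi(X,Y)=g(\phi X,Y)$ (here $(\eta\wedge\Phi)(X,Y,Z)$ is the cyclic sum of $\eta(X)\Phi(Y,Z)$, and $d\Phi(X,Y,Z)$ is the cyclic sum of $X\Phi(Y,Z)-\Phi([X,Y],Z)$). Put $h=\tfrac12\mathcal L_\xi\phi$. Let $\kappa,\mu,\nu$ be smooth functions on $M$ with $d\kappa\wedge\eta=d\mu\wedge\eta=d\nu\wedge\eta=0$, and assume that $M$ is a $(\kappa,\mu,\nu)$-space, i.e. that for all vector fields $X,Y$ $$R(X,Y)\xi=\eta(Y)(\kappa I+\mu h+\nu\phi h)X-\eta(X)(\kappa I+\mu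 h+\nu\phi h)Y,$$ where $R(X,Y)Z=\nabla_X\nabla_YZ-\nabla_Y\nabla_XZ-\nabla_{[X,Y]}Z$ is the curvature tensor of the Levi-Civita connection $\nabla$ of $g$. Let $Q$ be the Ricci operator, $QX=\sum_i R(X,E_i)E_i$ for a local orthonormal frame $(E_i)$. Then $$Q\phi-\phi Q=2\mu\,h\phi+2\bigl(2\alpha(n-1)+\nu\bigr)h$$ at every point of $M$ if $n\le 1$, and at every point where $\kappa\neq-\alpha^2$ (equivalently $h\ne0$) if $n\ge 2$. -/

import Mathlib

open Bundle VectorField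
open scoped Manifold ContDiff

noncomputable section

namespace AlmostCosymplectic

section Riemannian

variable {E : Type*} [NormedAddCommGroup E] [NormedSpace ℝ E] [FiniteDimensional ℝ E]
  {H : Type*} [TopologicalSpace H] (I : ModelWithCorners ℝ E H)
  {M : Type*} [TopologicalSpace M] [ChartedSpace H M]

instance instFiniteDimensionalTangentSpace (p : M) : FiniteDimensional ℝ (TangentSpace I p) :=
  inferInstanceAs (FiniteDimensional ℝ E)

variable [IsManifold I ∞ M]

/-- A vector field extending the tangent vector `v` at `p`, smooth near `p`. -/
def extendVector {p : M} (v : TangentSpace I p) : Π x : M, TangentSpace I x :=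
  FiberBundle.extend E v

variable [RiemannianBundle (fun x : M ↦ TangentSpace I x)]

/-- An orthonormal basis of the tangent space at `p` (with respect to the Riemannian metric). -/
def orthoFrame (p : M) :
    OrthonormalBasis (Fin (Module.finrank ℝ (TangentSpace I p))) ℝ (TangentSpace I p) :=
  stdOrthonormalBasis ℝ (TangentSpace I p)

/-- The right-hand side of the Koszul formula (with its factor `1/2`):
`½ (X g(Y,Z) + Y g(Z,X) - Z g(X,Y) + g([X,Y],Z) - g([Y,Z],X) + g([Z,X],Y))` at `p`. -/
def koszul (X Y Z : Π x : M, TangentSpace I x) (p : M) : ℝ :=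
  (1 / 2 : ℝ) *
    (mvfderiv I (fun x ↦ inner ℝ (Y x) (Z x)) p (X p)
      + mvfderiv I (fun x ↦ inner ℝ (Z x) (X x)) p (Y p)
      - mvfderiv I (fun x ↦ inner ℝ (X x) (Y x)) p (Z p)
      + inner ℝ (mlieBracket I X Y p) (Z p)
      - inner ℝ (mlieBracket I Y Z p) (X p)
      + inner ℝ (mlieBracket I Z X p) (Y p))

/-- The Levi-Civita connection `∇_X Y` at `p`: the tangent vector whose components in an
orthonormal basis `e_i` of `T_pM` are given by the Koszul formula (each `e_i` being extended to a
smooth vector field near `p`). It is characterised by `inner_leviCivita`. -/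
def leviCivita (X Y : Π x : M, TangentSpace I x) (p : M) : TangentSpace I p :=
  ∑ i, koszul I X Y (extendVector I (orthoFrame I p i)) p • orthoFrame I p i

/-- `R(X,Y)Z = ∇_X ∇_Y Z - ∇_Y ∇_X Z - ∇_[X,Y] Z` for vector fields. -/
def curvatureField (X Y Z : Π x : M, TangentSpace I x) (p : M) : TangentSpace I p :=
  leviCivita I X (leviCivita I Y Z) p - leviCivita I Y (leviCivita I X Z) p
    - leviCivita I (mlieBracket I X Y) Z p

/-- The Riemann curvature tensor `R(u,v)w` on tangent vectors at `p`, evaluated through smooth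
extensions of the vectors to vector fields near `p`. -/
def curvature (p : M) (u v w : TangentSpace I p) : TangentSpace I p :=
  curvatureField I (extendVector I u) (extendVector I v) (extendVector I w) p

/-- The Ricci operator `Q v = ∑ R(v, e_i) e_i`, with `e_i` an orthonormal basis of `T_pM`. -/
def ricciOperator (p : M) (v : TangentSpace I p) : TangentSpace I p :=
  ∑ i, curvature I p v (orthoFrame I p i) (orthoFrame I p i)

variable [IsContMDiffRiemannianBundle I ∞ E (fun x : M ↦ TangentSpace I x)]

theorem mdifferentiableAt_inner {Y Z : Π x : M, TangentSpace I x} {p : M}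
    (hY : MDifferentiableAt I I.tangent (fun x ↦ (⟨x, Y x⟩ : TangentBundle I M)) p)
    (hZ : MDifferentiableAt I I.tangent (fun x ↦ (⟨x, Z x⟩ : TangentBundle I M)) p) :
    MDifferentiableAt I 𝓘(ℝ, ℝ) (fun x ↦ (inner ℝ (Y x) (Z x) : ℝ)) p :=
  MDifferentiableAt.inner_bundle (F := E) (E := fun x : M ↦ TangentSpace I x) hY hZ

theorem koszul_tensorial {X Y : Π x : M, TangentSpace I x} {p : M}
    (hX : MDifferentiableAt I I.tangent (fun x ↦ (⟨x, X x⟩ : TangentBundle I M)) p)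
    (hY : MDifferentiableAt I I.tangent (fun x ↦ (⟨x, Y x⟩ : TangentBundle I M)) p) :
    TensorialAt I E (fun Z : Π x : M, TangentSpace I x ↦ koszul I X Y Z p) p where
  smul {f Z} hf hZ := by
    have h1 := mvfderiv_fun_mul (I := I) hf (mdifferentiableAt_inner I hY hZ)
    have h2 := mvfderiv_fun_mul (I := I) hf (mdifferentiableAt_inner I hZ hX)
    simp only [koszul, Pi.smul_apply', real_inner_smul_left, real_inner_smul_right,
      mlieBracket_smul_left hf hZ, mlieBracket_smul_right hf hZ, h1, h2]
    simp [inner_add_left, inner_smul_left, real_inner_comm]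
    ring
  add {Z Z'} hZ hZ' := by
    have h1 := mvfderiv_fun_add (I := I) (mdifferentiableAt_inner I hY hZ) (mdifferentiableAt_inner I hY hZ')
    have h2 := mvfderiv_fun_add (I := I) (mdifferentiableAt_inner I hZ hX) (mdifferentiableAt_inner I hZ' hX)
    simp only [koszul, Pi.add_apply, inner_add_left, inner_add_right,
      mlieBracket_add_left hZ hZ', mlieBracket_add_right hZ hZ', h1, h2]
    simp
    ring

/-- The Koszul formula `g(∇_X Y, Z) = koszul X Y Z`. -/
theorem inner_leviCivita {X Y Z : Π x : M, TangentSpace I x} {p : M}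
    (hX : MDifferentiableAt I I.tangent (fun x ↦ (⟨x, X x⟩ : TangentBundle I M)) p)
    (hY : MDifferentiableAt I I.tangent (fun x ↦ (⟨x, Y x⟩ : TangentBundle I M)) p)
    (hZ : MDifferentiableAt I I.tangent (fun x ↦ (⟨x, Z x⟩ : TangentBundle I M)) p) :
    inner ℝ (leviCivita I X Y p) (Z p) = koszul I X Y Z p := by
  have hT := koszul_tensorial I hX hY
  rw [← TensorialAt.mkHom_apply hT hZ]
  nth_rewrite 2 [← (orthoFrame I p).sum_repr (Z p)]
  simp only [leviCivita, sum_inner, map_sum, map_smul, inner_smul_left,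
    TensorialAt.mkHom_apply_eq_extend, extendVector, OrthonormalBasis.repr_apply_apply]
  simp [mul_comm]

end Riemannian

section AlmostContact

variable {E : Type*} [NormedAddCommGroup E] [NormedSpace ℝ E]
  {H : Type*} [TopologicalSpace H] (I : ModelWithCorners ℝ E H)
  {M : Type*} [TopologicalSpace M] [ChartedSpace H M]

/-- `dη(X,Y) = X(η(Y)) - Y(η(X)) - η([X,Y])` for a `1`-form `η`. -/
def extDerivOne (η : Π x : M, TangentSpace I x →L[ℝ] ℝ)
    (X Y : Π x : M, TangentSpace I x) (p : M) : ℝ :=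
  mvfderiv I (fun x ↦ η x (Y x)) p (X p) - mvfderiv I (fun x ↦ η x (X x)) p (Y p)
    - η p (mlieBracket I X Y p)

/-- `dΦ(X,Y,Z) = XΦ(Y,Z) + YΦ(Z,X) + ZΦ(X,Y) - Φ([X,Y],Z) - Φ([Y,Z],X) - Φ([Z,X],Y)` for a
`2`-form `Φ`. -/
def extDerivTwo (Φ : Π x : M, TangentSpace I x → TangentSpace I x → ℝ)
    (X Y Z : Π x : M, TangentSpace I x) (p : M) : ℝ :=
  mvfderiv I (fun x ↦ Φ x (Y x) (Z x)) p (X p)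
    + mvfderiv I (fun x ↦ Φ x (Z x) (X x)) p (Y p)
    + mvfderiv I (fun x ↦ Φ x (X x) (Y x)) p (Z p)
    - Φ p (mlieBracket I X Y p) (Z p)
    - Φ p (mlieBracket I Y Z p) (X p)
    - Φ p (mlieBracket I Z X p) (Y p)

/-- `(η ∧ Φ)(u,v,w) = η(u)Φ(v,w) + η(v)Φ(w,u) + η(w)Φ(u,v)`. -/
def wedgeOneTwo (η : Π x : M, TangentSpace I x →L[ℝ] ℝ)
    (Φ : Π x : M, TangentSpace I x → TangentSpace I x → ℝ)
    (p : M) (u v w : TangentSpace I p) : ℝ :=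
  η p u * Φ p v w + η p v * Φ p w u + η p w * Φ p u v

/-- `f` belongs to the ring `R_η(M)`: it is a smooth function with `df ∧ η = 0`. -/
structure IsInRingEta (η : Π x : M, TangentSpace I x →L[ℝ] ℝ) (f : M → ℝ) : Prop where
  smooth : ContMDiff I 𝓘(ℝ, ℝ) ∞ f
  wedge_eq_zero : ∀ (p : M) (u v : TangentSpace I p),
    mvfderiv I f p u * η p v - mvfderiv I f p v * η p u = 0

variable [IsManifold I ∞ M]

/-- `X` is a vector field that is smooth around `p`. -/
def SmoothFieldAt (X : Π x : M, TangentSpace I x) (p : M) : Prop :=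
  ContMDiffAt I I.tangent ∞ (fun x ↦ (⟨x, X x⟩ : TangentBundle I M)) p

variable [RiemannianBundle (fun x : M ↦ TangentSpace I x)]

/-- The fundamental `2`-form `Φ(u,v) = g(φ u, v)`. -/
def fundamentalForm (φ : Π x : M, TangentSpace I x →L[ℝ] TangentSpace I x)
    (p : M) (u v : TangentSpace I p) : ℝ :=
  inner ℝ (φ p u) v

/-- `(φ, ξ, η, g)` is an almost contact metric structure, where `g` is the given Riemannian
metric: `φ² = -I + η ⊗ ξ`, `η(ξ) = 1`, `g(φ u, φ v) = g(u, v) - η(u) η(v)`, all tensors smooth. -/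
structure IsAlmostContactMetric (φ : Π x : M, TangentSpace I x →L[ℝ] TangentSpace I x)
    (ξ : Π x : M, TangentSpace I x) (η : Π x : M, TangentSpace I x →L[ℝ] ℝ) : Prop where
  smooth_phi : ContMDiff I (I.prod 𝓘(ℝ, E →L[ℝ] E)) ∞
    (fun x ↦ TotalSpace.mk' (E →L[ℝ] E)
      (E := fun x : M ↦ TangentSpace I x →L[ℝ] TangentSpace I x) x (φ x))
  smooth_xi : ContMDiff I I.tangent ∞ (fun x ↦ (⟨x, ξ x⟩ : TangentBundle I M))
  smooth_eta : ContMDiff I (I.prod 𝓘(ℝ, E →L[ℝ] ℝ)) ∞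
    (fun x ↦ TotalSpace.mk' (E →L[ℝ] ℝ) (E := fun x : M ↦ TangentSpace I x →L[ℝ] ℝ) x (η x))
  phi_phi : ∀ (p : M) (v : TangentSpace I p), φ p (φ p v) = -v + η p v • ξ p
  eta_xi : ∀ p : M, η p (ξ p) = 1
  compatible : ∀ (p : M) (u v : TangentSpace I p),
    inner ℝ (φ p u) (φ p v) = inner ℝ u v - η p u * η p v

/-- `(φ, ξ, η, g)` is an almost `α`-cosymplectic structure: an almost contact metric structure with
`dη = 0` and `dΦ = 2α η ∧ Φ`. -/
structure IsAlmostAlphaCosymplectic (α : ℝ)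
    (φ : Π x : M, TangentSpace I x →L[ℝ] TangentSpace I x)
    (ξ : Π x : M, TangentSpace I x) (η : Π x : M, TangentSpace I x →L[ℝ] ℝ) : Prop
    extends IsAlmostContactMetric I φ ξ η where
  d_eta : ∀ (p : M) (X Y : Π x : M, TangentSpace I x),
    SmoothFieldAt I X p → SmoothFieldAt I Y p → extDerivOne I η X Y p = 0
  d_fundamentalForm : ∀ (p : M) (X Y Z : Π x : M, TangentSpace I x),
    SmoothFieldAt I X p → SmoothFieldAt I Y p → SmoothFieldAt I Z p →
    extDerivTwo I (fundamentalForm I φ) X Y Z p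
      = 2 * α * wedgeOneTwo I η (fundamentalForm I φ) p (X p) (Y p) (Z p)

/-- The tensor `h = ½ L_ξ φ`, i.e. `h X = ½ ([ξ, φ X] - φ [ξ, X])`; on a tangent vector it is
evaluated through a smooth extension of the vector to a vector field near `p`. -/
def hTensor (φ : Π x : M, TangentSpace I x →L[ℝ] TangentSpace I x)
    (ξ : Π x : M, TangentSpace I x) (p : M) (v : TangentSpace I p) : TangentSpace I p :=
  (1 / 2 : ℝ) •
    (mlieBracket I ξ (fun x ↦ φ x (extendVector I v x)) p
      - φ p (mlieBracket I ξ (extendVector I v) p))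

/-- `(κ I + μ h + ν φ h) v`. -/
def nullityOperator (φ : Π x : M, TangentSpace I x →L[ℝ] TangentSpace I x)
    (ξ : Π x : M, TangentSpace I x) (κ μ ν : M → ℝ) (p : M) (v : TangentSpace I p) :
    TangentSpace I p :=
  κ p • v + μ p • hTensor I φ ξ p v + ν p • φ p (hTensor I φ ξ p v)

/-- `M` with `(φ, ξ, η, g)` is an almost `α`-cosymplectic `(κ,μ,ν)`-space: the structure is almost
`α`-cosymplectic, `κ, μ, ν ∈ R_η(M)`, and
`R(u,v)ξ = η(v)(κ I + μ h + ν φ h)u - η(u)(κ I + μ h + ν φ h)v`. -/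
structure IsKappaMuNuSpace [FiniteDimensional ℝ E] (α : ℝ)
    (φ : Π x : M, TangentSpace I x →L[ℝ] TangentSpace I x)
    (ξ : Π x : M, TangentSpace I x) (η : Π x : M, TangentSpace I x →L[ℝ] ℝ)
    (κ μ ν : M → ℝ) : Prop
    extends IsAlmostAlphaCosymplectic I α φ ξ η where
  kappa_mem : IsInRingEta I η κ
  mu_mem : IsInRingEta I η μ
  nu_mem : IsInRingEta I η ν
  nullity : ∀ (p : M) (u v : TangentSpace I p),
    curvature I p u v (ξ p)
      = η p v • nullityOperator I φ ξ κ μ ν p u - η p u • nullityOperator I φ ξ κ μ ν p v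

end AlmostContact

end AlmostCosymplectic

end

open AlmostCosymplectic

/-!
Write `B = ∇ξ`. The idea is that, under the nullity condition, the leaves of the distribution
`ker η` are Kähler manifolds, so that `∇φ` is an explicit expression in `φ` and `B`; the Ricci
identity then gives the commutators `[R(X,Y), φ]`, and tracing these gives `Qφ - φQ`.

* `dη = 0` says that `B` is symmetric. Contracting `dΦ = 2α η ∧ Φ` with `ξ` gives `∇_ξφ = 0` and
  `φB + Bφ = 2αφ` (`nablaXiPhi_eq_zero_and_anticommute`), hence `h = φB - αφ`
  (`IsAlmostAlphaCosymplectic.hTensor_eq`).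
* As `R(X,Y)ξ = (∇_X B)Y - (∇_Y B)X`, the nullity condition for `R(X,ξ)ξ` yields
  `B² = 2αB + (κ + 2α²)φ²` (`IsKappaMuNuSpace.nablaXi_nablaXi`), and for `X, Y ∈ ker η` it is the
  Codazzi equation. Put `S = α - B`, so that `S² = -(κ + α²)` on `ker η`. Since `κ` is constant
  along `ker η`, the operators `S` and `∇_X S` anticommute there; together with the Codazzi
  equation this forces `∇S = 0` along `ker η` if `κ ≠ -α²`. Then `∇φ` anticommutes with `S` too, and
  the symmetries of `∇φ` on the eigenspaces of `S`, which `φ` interchanges, show that `∇φ` has no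
  component in `ker η` (`ReebAlgebra.inner_nablaPhi_eq_zero`). In dimension at most three the same
  conclusion is automatic (`ReebAlgebra.inner_nablaPhi_eq_zero_of_finrank_le`). So
  `(∇_X φ)Y = g(φBX, Y)ξ - η(Y)φBX` (`IsKappaMuNuSpace.hasKaehlerLeavesAt`).
* The condition `κ ≠ -α²` is open, so this formula may be differentiated, which gives `[R(X,Y), φ]`
  (`IsAlmostContactMetric.curvature_phi`). Contracting it as `∑ [R(X,E_i), φ]E_i` and as
  `∑ [R(E_i,φE_i), φ]X`, and relating the two by the first Bianchi identity, gives the formula for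
  `Qφ - φQ` (`ReebAlgebra.ricci_commutator`), with `tr B = 2nα`.

The Levi-Civita connection is given by the Koszul formula, and its curvature by second derivatives
of smooth extensions of tangent vectors. Everything is therefore developed for germs of smooth
fields: `SmoothNear` is preserved by brackets and by `∇`, the latter because Gram-Schmidt provides
smooth orthogonal frames (`smoothNear_of_inner`), and `GermTensorial` is the resulting criterion for
tensoriality.
-/

set_option linter.unusedSectionVars false

noncomputable section

namespace AlmostCosymplectic

open Topology

/-! ### Functions and vector fields that are smooth near a point -/

section Germs

variable {E : Type*} [NormedAddCommGroup E] [NormedSpace ℝ E]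
  {H : Type*} [TopologicalSpace H] (I : ModelWithCorners ℝ E H)
  {M : Type*} [TopologicalSpace M] [ChartedSpace H M]

/-- `f` is smooth on a neighbourhood of `p`. -/
def SmoothFunNear (f : M → ℝ) (p : M) : Prop :=
  ∀ᶠ x in 𝓝 p, ContMDiffAt I 𝓘(ℝ, ℝ) ∞ f x

variable {I} {p : M} {f g : M → ℝ}

theorem SmoothFunNear.contMDiffAt (h : SmoothFunNear I f p) : ContMDiffAt I 𝓘(ℝ, ℝ) ∞ f p :=
  h.self_of_nhds

theorem SmoothFunNear.mdifferentiableAt (h : SmoothFunNear I f p) :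
    MDifferentiableAt I 𝓘(ℝ, ℝ) f p :=
  h.contMDiffAt.mdifferentiableAt (by simp)

theorem SmoothFunNear.eventually (h : SmoothFunNear I f p) : ∀ᶠ x in 𝓝 p, SmoothFunNear I f x :=
  eventually_eventually_nhds.2 h

theorem SmoothFunNear.congr (h : SmoothFunNear I f p) (hfg : ∀ᶠ x in 𝓝 p, g x = f x) :
    SmoothFunNear I g p := by
  filter_upwards [h, eventually_eventually_nhds.2 hfg] with x hx hx'
  exact ContMDiffAt.congr_of_eventuallyEq hx hx'

theorem smoothFunNear_const (c : ℝ) : SmoothFunNear I (fun _ : M ↦ c) p :=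
  Filter.Eventually.of_forall fun _ ↦ contMDiffAt_const

theorem SmoothFunNear.add (hf : SmoothFunNear I f p) (hg : SmoothFunNear I g p) :
    SmoothFunNear I (fun x ↦ f x + g x) p := by
  filter_upwards [hf, hg] with x h h' using ContMDiffAt.add h h'

theorem SmoothFunNear.sub (hf : SmoothFunNear I f p) (hg : SmoothFunNear I g p) :
    SmoothFunNear I (fun x ↦ f x - g x) p := by
  filter_upwards [hf, hg] with x h h' using ContMDiffAt.sub h h'

theorem SmoothFunNear.mul (hf : SmoothFunNear I f p) (hg : SmoothFunNear I g p) :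
    SmoothFunNear I (fun x ↦ f x * g x) p := by
  filter_upwards [hf, hg] with x h h' using ContMDiffAt.mul h h'

theorem SmoothFunNear.div (hf : SmoothFunNear I f p) (hg : SmoothFunNear I g p)
    (h0 : ∀ᶠ x in 𝓝 p, g x ≠ 0) : SmoothFunNear I (fun x ↦ f x / g x) p := by
  filter_upwards [hf, hg, h0] with x h h' h0 using ContMDiffAt.div₀ h h' h0

variable [IsManifold I ∞ M]

variable (I) in
/-- `X` is a vector field that is smooth on a neighbourhood of `p`. For smoothness of order `∞` this
is stronger than `SmoothFieldAt I X p`, and unlike the latter it is an open condition on `p`. -/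
def SmoothNear (X : Π x : M, TangentSpace I x) (p : M) : Prop :=
  ∀ᶠ x in 𝓝 p, SmoothFieldAt I X x

variable {X Y : Π x : M, TangentSpace I x}

theorem SmoothNear.smoothFieldAt (h : SmoothNear I X p) : SmoothFieldAt I X p :=
  h.self_of_nhds

theorem SmoothNear.mdifferentiableAt (h : SmoothNear I X p) :
    MDifferentiableAt I I.tangent (fun x ↦ (⟨x, X x⟩ : TangentBundle I M)) p :=
  ContMDiffAt.mdifferentiableAt h.smoothFieldAt (by simp)

theorem SmoothNear.eventually (h : SmoothNear I X p) : ∀ᶠ x in 𝓝 p, SmoothNear I X x :=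
  eventually_eventually_nhds.2 h

theorem SmoothNear.congr (h : SmoothNear I X p) (hXY : ∀ᶠ x in 𝓝 p, Y x = X x) :
    SmoothNear I Y p := by
  filter_upwards [h, eventually_eventually_nhds.2 hXY] with x hx hx'
  refine ContMDiffAt.congr_of_eventuallyEq hx ?_
  filter_upwards [hx'] with y hy
  rw [hy]

theorem SmoothNear.add (hX : SmoothNear I X p) (hY : SmoothNear I Y p) :
    SmoothNear I (X + Y) p := by
  filter_upwards [hX, hY] with x h h' using ContMDiffAt.add_section h h'

theorem SmoothNear.sub (hX : SmoothNear I X p) (hY : SmoothNear I Y p) :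
    SmoothNear I (X - Y) p := by
  filter_upwards [hX, hY] with x h h' using ContMDiffAt.sub_section h h'

theorem SmoothNear.neg (hX : SmoothNear I X p) : SmoothNear I (-X) p := by
  filter_upwards [hX] with x h using ContMDiffAt.neg_section h

theorem SmoothNear.smul (hf : SmoothFunNear I f p) (hX : SmoothNear I X p) :
    SmoothNear I (f • X) p := by
  filter_upwards [hf, hX] with x h h' using ContMDiffAt.smul_section h h'

theorem SmoothNear.const_smul (c : ℝ) (hX : SmoothNear I X p) :
    SmoothNear I (c • X) p := by
  filter_upwards [hX] with x h using ContMDiffAt.const_smul_section h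

theorem SmoothNear.sum {ι : Type*} {s : Finset ι} {Z : ι → Π x : M, TangentSpace I x}
    (hZ : ∀ i ∈ s, SmoothNear I (Z i) p) : SmoothNear I (fun x ↦ ∑ i ∈ s, Z i x) p := by
  have : ∀ᶠ x in 𝓝 p, ∀ i ∈ s, SmoothFieldAt I (Z i) x := (Filter.eventually_all_finset s).2 hZ
  filter_upwards [this] with x h using ContMDiffAt.sum_section h

theorem smoothNear_extendVector [FiniteDimensional ℝ E] (v : TangentSpace I p) :
    SmoothNear I (extendVector I v) p := by
  obtain ⟨s, hs, h⟩ := FiberBundle.exists_contMDiffOn_extend (k := ∞) I E v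
  filter_upwards [eventually_eventually_nhds.2 hs] with x hx
  exact h.contMDiffAt hx

@[simp]
theorem extendVector_self [FiniteDimensional ℝ E] (v : TangentSpace I p) :
    extendVector I v p = v :=
  FiberBundle.extend_apply_self E v

theorem smoothNear_mlieBracket [CompleteSpace E] (hX : SmoothNear I X p) (hY : SmoothNear I Y p) :
    SmoothNear I (mlieBracket I X Y) p := by
  filter_upwards [hX, hY] with x h h'
  have : IsManifold I (minSmoothness ℝ 2) M := by
    rw [minSmoothness_of_isRCLikeNormedField]; infer_instance
  have : IsManifold I (minSmoothness ℝ 3) M := by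
    rw [minSmoothness_of_isRCLikeNormedField]; infer_instance
  have : IsManifold I (((⊤ : ℕ∞) : WithTop ℕ∞) + 1) M := by simpa using ‹IsManifold I ∞ M›
  exact ContMDiffAt.mlieBracket_vectorField (m := ⊤) (n := ⊤) h h' (by simp)

theorem smoothFunNear_mvfderiv (hf : SmoothFunNear I f p) (hX : SmoothNear I X p) :
    SmoothFunNear I (fun x ↦ mvfderiv I f x (X x)) p := by
  filter_upwards [hf, hX] with x h h'
  have h1 := h.mfderiv_const (m := ∞) (by simp)
  have h2 : ContMDiffAt I (I.prod 𝓘(ℝ, E →L[ℝ] ℝ)) ∞ (fun x ↦ TotalSpace.mk' (E →L[ℝ] ℝ)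
      (E := fun x : M ↦ TangentSpace I x →L[ℝ] Bundle.Trivial M ℝ x) x (mvfderiv I f x)) x := by
    rw [contMDiffAt_hom_bundle]
    refine ⟨contMDiffAt_id, h1.congr_of_eventuallyEq (Filter.Eventually.of_forall fun y ↦ ?_)⟩
    ext v
    simp [inTangentCoordinates, ContinuousLinearMap.inCoordinates, mvfderiv]
    rfl
  have h3 := ContMDiffAt.clm_bundle_apply (F₁ := E) (F₂ := ℝ) (E₂ := Bundle.Trivial M ℝ) h2 h'
  rw [contMDiffAt_totalSpace] at h3
  exact h3.2

end Germs

/-! ### Local frames and tensoriality -/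

section Frames

variable {E : Type*} [NormedAddCommGroup E] [NormedSpace ℝ E] [FiniteDimensional ℝ E]
  {H : Type*} [TopologicalSpace H] {I : ModelWithCorners ℝ E H}
  {M : Type*} [TopologicalSpace M] [ChartedSpace H M] [IsManifold I ∞ M]

/-- A smooth local frame near `p` in which smooth vector fields have smooth coefficients that depend
linearly on the value of the field. -/
theorem exists_smooth_frame (p : M) : ∃ (s : Fin (Module.finrank ℝ E) → Π x : M, TangentSpace I x)
    (c : Fin (Module.finrank ℝ E) → Π x : M, TangentSpace I x →ₗ[ℝ] ℝ),
    (∀ i, SmoothNear I (s i) p) ∧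
    (∀ᶠ x in 𝓝 p, LinearIndependent ℝ (fun i ↦ s i x)) ∧
    (∀ X : Π x : M, TangentSpace I x, SmoothNear I X p →
      ∀ i, SmoothFunNear I (fun x ↦ c i x (X x)) p) ∧
    (∀ᶠ x in 𝓝 p, ∀ v : TangentSpace I x, v = ∑ i, c i x v • s i x) := by
  let t := trivializationAt E (TangentSpace I : M → Type _) p
  have hp : p ∈ t.baseSet := FiberBundle.mem_baseSet_trivializationAt E _ p
  let b := Module.finBasis ℝ E
  have hU : ∀ᶠ x in 𝓝 p, x ∈ t.baseSet := t.open_baseSet.mem_nhds hp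
  refine ⟨t.localFrame b, t.localFrameCoeff I b, fun i ↦ ?_, ?_, fun X hX i ↦ ?_, ?_⟩
  · filter_upwards [hU] with x hx using contMDiffAt_localFrame_of_mem ∞ _ b i hx
  · filter_upwards [hU] with x hx
    exact (t.isLocalFrameOn_localFrame_baseSet I ∞ b).linearIndependent hx
  · filter_upwards [hU, hX] with x hx hX
    exact contMDiffAt_localFrameCoeff b hx hX i
  · filter_upwards [hU] with x hx v
    have := t.eq_sum_localFrameCoeff_smul (I := I) (b := b) (s := extendVector I v) hx
    simpa using this

variable {A : Type*} [AddCommGroup A] [Module ℝ A]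

variable (I) in
/-- An operation on germs at `p` of smooth vector fields is *tensorial* if it is linear over smooth
functions. In contrast to `TensorialAt` this asks nothing about fields that are merely
differentiable, so that it applies to operations involving second derivatives. -/
structure GermTensorial (Φ : (Π x : M, TangentSpace I x) → A) (p : M) : Prop where
  smul : ∀ {f : M → ℝ} {X : Π x : M, TangentSpace I x}, SmoothFunNear I f p → SmoothNear I X p →
    Φ (f • X) = f p • Φ X
  add : ∀ {X Y : Π x : M, TangentSpace I x}, SmoothNear I X p → SmoothNear I Y p →
    Φ (X + Y) = Φ X + Φ Y

namespace GermTensorial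

variable {Φ : (Π x : M, TangentSpace I x) → A} {p : M} {X Y : Π x : M, TangentSpace I x}

theorem congr_eventually (hΦ : GermTensorial I Φ p) (hX : SmoothNear I X p)
    (hY : SmoothNear I Y p) (h : ∀ᶠ x in 𝓝 p, X x = Y x) : Φ X = Φ Y := by
  classical
  -- Multiply both fields by the indicator function of the set on which they agree.
  let ψ : M → ℝ := fun x ↦ if X x = Y x then 1 else 0
  have hψp : ψ p = 1 := if_pos h.self_of_nhds
  have hψ : SmoothFunNear I ψ p :=
    (smoothFunNear_const 1).congr (h.mono fun x hx ↦ if_pos hx)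
  have hXY : ψ • X = ψ • Y := by
    funext x
    by_cases hx : X x = Y x <;> simp [ψ, hx]
  have h1 := hΦ.smul hψ hX
  rw [hXY, hΦ.smul hψ hY, hψp, one_smul, one_smul] at h1
  exact h1.symm

theorem map_zero (hΦ : GermTensorial I Φ p) : Φ 0 = 0 := by
  have h0 : SmoothNear I (0 : Π x : M, TangentSpace I x) p :=
    Filter.Eventually.of_forall fun x ↦ contMDiff_zeroSection ℝ (TangentSpace I : M → Type _) x
  have := hΦ.smul (f := fun _ ↦ 0) (smoothFunNear_const 0) h0
  rwa [zero_smul, smul_zero] at this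

theorem map_sum (hΦ : GermTensorial I Φ p) {ι : Type*} (s : Finset ι)
    {Z : ι → Π x : M, TangentSpace I x} (hZ : ∀ i ∈ s, SmoothNear I (Z i) p) :
    Φ (fun x ↦ ∑ i ∈ s, Z i x) = ∑ i ∈ s, Φ (Z i) := by
  classical
  induction s using Finset.induction_on with
  | empty => exact hΦ.map_zero
  | insert a s ha ih =>
    simp only [Finset.mem_insert, forall_eq_or_imp] at hZ
    simp only [Finset.sum_insert ha, ← ih hZ.2]
    exact hΦ.add hZ.1 (SmoothNear.sum hZ.2)

/-- A tensorial operation depends only on the value of the vector field at the point. -/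
theorem pointwise (hΦ : GermTensorial I Φ p) (hX : SmoothNear I X p) (hY : SmoothNear I Y p)
    (h : X p = Y p) : Φ X = Φ Y := by
  obtain ⟨s, c, hs, -, hc, hsum⟩ := exists_smooth_frame (I := I) p
  have key : ∀ Z : Π x : M, TangentSpace I x, SmoothNear I Z p →
      Φ Z = ∑ i, c i p (Z p) • Φ (s i) := by
    intro Z hZ
    have hi : ∀ i ∈ Finset.univ, SmoothNear I ((fun x ↦ c i x (Z x)) • s i) p :=
      fun i _ ↦ (hs i).smul (hc Z hZ i)
    rw [hΦ.congr_eventually hZ (SmoothNear.sum hi) (hsum.mono fun x hx ↦ hx (Z x)),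
      hΦ.map_sum _ hi]
    exact Finset.sum_congr rfl fun i _ ↦ hΦ.smul (hc Z hZ i) (hs i)
  rw [key X hX, key Y hY, h]

/-- The linear map on the tangent space induced by a tensorial operation. -/
def toLinearMap (Φ : (Π x : M, TangentSpace I x) → A) (hΦ : GermTensorial I Φ p) :
    TangentSpace I p →ₗ[ℝ] A where
  toFun v := Φ (extendVector I v)
  map_add' u v := by
    rw [← hΦ.add (smoothNear_extendVector u) (smoothNear_extendVector v)]
    exact hΦ.pointwise (smoothNear_extendVector _)
      ((smoothNear_extendVector u).add (smoothNear_extendVector v)) (by simp)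
  map_smul' r v := by
    have := hΦ.smul (smoothFunNear_const r) (smoothNear_extendVector v)
    rw [RingHom.id_apply, ← this]
    exact hΦ.pointwise (smoothNear_extendVector _)
      ((smoothNear_extendVector v).smul (smoothFunNear_const r)) (by simp)

theorem toLinearMap_apply (hΦ : GermTensorial I Φ p) (hX : SmoothNear I X p) :
    hΦ.toLinearMap Φ (X p) = Φ X :=
  hΦ.pointwise (smoothNear_extendVector _) hX (by simp)

end GermTensorial

variable [RiemannianBundle (fun x : M ↦ TangentSpace I x)]
  [IsContMDiffRiemannianBundle I ∞ E (fun x : M ↦ TangentSpace I x)]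
  {p : M} {X Y : Π x : M, TangentSpace I x}

theorem SmoothNear.inner_field (hX : SmoothNear I X p) (hY : SmoothNear I Y p) :
    SmoothFunNear I (fun x ↦ inner ℝ (X x) (Y x)) p := by
  filter_upwards [hX, hY] with x h h'
  exact ContMDiffAt.inner_bundle (F := E) (E := fun x : M ↦ TangentSpace I x) h h'

/-- Near every point there is a smooth orthogonal frame: apply Gram-Schmidt to any smooth frame. -/
theorem exists_smooth_orthogonal_frame (p : M) :
    ∃ s : Fin (Module.finrank ℝ E) → Π x : M, TangentSpace I x,
    (∀ i, SmoothNear I (s i) p) ∧ (∀ i, ∀ᶠ x in 𝓝 p, s i x ≠ 0) ∧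
    (∀ᶠ x in 𝓝 p, ∀ v : TangentSpace I x,
      v = ∑ i, (inner ℝ (s i x) v / inner ℝ (s i x) (s i x) : ℝ) • s i x) := by
  obtain ⟨s, c, hs, hli, -, hsum⟩ := exists_smooth_frame (I := I) p
  let w : Fin (Module.finrank ℝ E) → Π x : M, TangentSpace I x :=
    fun i x ↦ InnerProductSpace.gramSchmidt ℝ (fun j ↦ s j x) i
  have hw0 : ∀ i, ∀ᶠ x in 𝓝 p, w i x ≠ 0 := fun i ↦ by
    filter_upwards [hli] with x hx using InnerProductSpace.gramSchmidt_ne_zero i hx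
  refine ⟨w, fun i ↦ ?_, hw0, ?_⟩
  · induction i using WellFoundedLT.induction with
    | ind i ih =>
      have hrec : w i = s i - fun x ↦ ∑ j ∈ Finset.Iio i,
          (inner ℝ (w j x) (s i x) / inner ℝ (w j x) (w j x) : ℝ) • w j x := by
        funext x
        have := InnerProductSpace.gramSchmidt_def'' ℝ (fun j ↦ s j x) i
        rw [Pi.sub_apply, eq_sub_iff_add_eq]
        simpa only [w, real_inner_self_eq_norm_sq, RCLike.ofReal_real_eq_id, id] using this.symm
      rw [hrec]
      refine (hs i).sub (SmoothNear.sum (Z := fun j x ↦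
        (inner ℝ (w j x) (s i x) / inner ℝ (w j x) (w j x) : ℝ) • w j x) fun j hj ↦ ?_)
      have hj' := ih j (Finset.mem_Iio.1 hj)
      exact SmoothNear.smul ((hj'.inner_field (hs i)).div (hj'.inner_field hj')
        ((hw0 j).mono fun x hx ↦ inner_self_ne_zero.2 hx)) hj'
  · filter_upwards [hli, hsum] with x hx hx' v
    have hspan : Submodule.span ℝ (Set.range fun i ↦ w i x) = ⊤ := by
      have h1 : Submodule.span ℝ (Set.range fun i ↦ w i x)
          = Submodule.span ℝ (Set.range fun i ↦ s i x) :=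
        InnerProductSpace.span_gramSchmidt ℝ (fun j ↦ s j x)
      rw [h1, eq_top_iff]
      intro u _
      rw [hx' u]
      exact Submodule.sum_mem _ fun i _ ↦
        Submodule.smul_mem _ _ (Submodule.subset_span ⟨i, rfl⟩)
    have horth : ∀ i j, i ≠ j → inner ℝ (w i x) (w j x) = 0 := fun i j hij ↦
      InnerProductSpace.gramSchmidt_orthogonal ℝ (fun j ↦ s j x) hij
    have hne : ∀ i, w i x ≠ 0 := fun i ↦ InnerProductSpace.gramSchmidt_ne_zero i hx
    have hv : v ∈ Submodule.span ℝ (Set.range fun i ↦ w i x) := hspan ▸ Submodule.mem_top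
    obtain ⟨a, rfl⟩ := (Submodule.mem_span_range_iff_exists_fun ℝ).1 hv
    refine Finset.sum_congr rfl fun i _ ↦ ?_
    congr 1
    rw [inner_sum, Finset.sum_eq_single i]
    · rw [real_inner_smul_right, mul_div_assoc, div_self (inner_self_ne_zero.2 (hne i)), mul_one]
    · intro j _ hj
      rw [real_inner_smul_right, horth i j hj.symm, mul_zero]
    · simp

/-- A vector field is smooth as soon as its inner products with smooth fields are. -/
theorem smoothNear_of_inner
    (h : ∀ Z : Π x : M, TangentSpace I x, SmoothNear I Z p →
      SmoothFunNear I (fun x ↦ inner ℝ (Z x) (X x)) p) : SmoothNear I X p := by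
  obtain ⟨s, hs, h0, hsum⟩ := exists_smooth_orthogonal_frame (I := I) p
  refine SmoothNear.congr (SmoothNear.sum (s := Finset.univ)
    (Z := fun i x ↦ (inner ℝ (s i x) (X x) / inner ℝ (s i x) (s i x) : ℝ) • s i x) fun i _ ↦ ?_)
    (hsum.mono fun x hx ↦ hx (X x))
  exact SmoothNear.smul ((h _ (hs i)).div ((hs i).inner_field (hs i))
    ((h0 i).mono fun x hx ↦ inner_self_ne_zero.2 hx)) (hs i)

end Frames

/-! ### The Levi-Civita connection -/

section LeviCivita

variable {E : Type*} [NormedAddCommGroup E] [NormedSpace ℝ E] [FiniteDimensional ℝ E]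
  {H : Type*} [TopologicalSpace H] {I : ModelWithCorners ℝ E H}
  {M : Type*} [TopologicalSpace M] [ChartedSpace H M] [IsManifold I ∞ M]
  [RiemannianBundle (fun x : M ↦ TangentSpace I x)]
  [IsContMDiffRiemannianBundle I ∞ E (fun x : M ↦ TangentSpace I x)]
  {p : M} {X Y Z : Π x : M, TangentSpace I x} {f g : M → ℝ}

theorem eq_of_forall_inner_field {u w : TangentSpace I p}
    (h : ∀ Z : Π x : M, TangentSpace I x, SmoothNear I Z p →
      (inner ℝ u (Z p) : ℝ) = inner ℝ w (Z p)) : u = w := by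
  refine ext_inner_right ℝ fun v ↦ ?_
  simpa using h _ (smoothNear_extendVector v)

theorem SmoothNear.inner_leviCivita (hX : SmoothNear I X p) (hY : SmoothNear I Y p)
    (hZ : SmoothNear I Z p) : inner ℝ (leviCivita I X Y p) (Z p) = koszul I X Y Z p :=
  AlmostCosymplectic.inner_leviCivita I hX.mdifferentiableAt hY.mdifferentiableAt
    hZ.mdifferentiableAt

theorem leviCivita_add_left (hX : SmoothNear I X p) (hY : SmoothNear I Y p)
    (hZ : SmoothNear I Z p) :
    leviCivita I (X + Y) Z p = leviCivita I X Z p + leviCivita I Y Z p := by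
  refine eq_of_forall_inner_field fun W hW ↦ ?_
  have h1 := mvfderiv_fun_add (I := I) (hW.inner_field hX).mdifferentiableAt
    (hW.inner_field hY).mdifferentiableAt
  have h2 := mvfderiv_fun_add (I := I) (hX.inner_field hZ).mdifferentiableAt
    (hY.inner_field hZ).mdifferentiableAt
  rw [inner_add_left, (hX.add hY).inner_leviCivita hZ hW, hX.inner_leviCivita hZ hW,
    hY.inner_leviCivita hZ hW]
  simp only [koszul, Pi.add_apply, inner_add_left, inner_add_right,
    mlieBracket_add_left hX.mdifferentiableAt hY.mdifferentiableAt,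
    mlieBracket_add_right hX.mdifferentiableAt hY.mdifferentiableAt, h1, h2]
  simp
  ring

theorem leviCivita_add_right (hX : SmoothNear I X p) (hY : SmoothNear I Y p)
    (hZ : SmoothNear I Z p) :
    leviCivita I X (Y + Z) p = leviCivita I X Y p + leviCivita I X Z p := by
  refine eq_of_forall_inner_field fun W hW ↦ ?_
  have h1 := mvfderiv_fun_add (I := I) (hY.inner_field hW).mdifferentiableAt
    (hZ.inner_field hW).mdifferentiableAt
  have h2 := mvfderiv_fun_add (I := I) (hX.inner_field hY).mdifferentiableAt
    (hX.inner_field hZ).mdifferentiableAt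
  rw [inner_add_left, hX.inner_leviCivita (hY.add hZ) hW, hX.inner_leviCivita hY hW,
    hX.inner_leviCivita hZ hW]
  simp only [koszul, Pi.add_apply, inner_add_left, inner_add_right,
    mlieBracket_add_left hY.mdifferentiableAt hZ.mdifferentiableAt,
    mlieBracket_add_right hY.mdifferentiableAt hZ.mdifferentiableAt, h1, h2]
  simp
  ring

theorem leviCivita_smul_left (hf : SmoothFunNear I f p) (hX : SmoothNear I X p)
    (hY : SmoothNear I Y p) : leviCivita I (f • X) Y p = f p • leviCivita I X Y p := by
  refine eq_of_forall_inner_field fun W hW ↦ ?_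
  have h1 := mvfderiv_fun_mul (I := I) hf.mdifferentiableAt (hW.inner_field hX).mdifferentiableAt
  have h2 := mvfderiv_fun_mul (I := I) hf.mdifferentiableAt (hX.inner_field hY).mdifferentiableAt
  rw [real_inner_smul_left, (hX.smul hf).inner_leviCivita hY hW, hX.inner_leviCivita hY hW]
  simp only [koszul, Pi.smul_apply', real_inner_smul_left, real_inner_smul_right,
    mlieBracket_smul_left hf.mdifferentiableAt hX.mdifferentiableAt,
    mlieBracket_smul_right hf.mdifferentiableAt hX.mdifferentiableAt, h1, h2]
  simp [inner_add_left, inner_smul_left, real_inner_comm]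
  ring

/-- The Leibniz rule `∇_X (f Y) = (X f) Y + f ∇_X Y`. -/
theorem leviCivita_smul_right (hf : SmoothFunNear I f p) (hX : SmoothNear I X p)
    (hY : SmoothNear I Y p) :
    leviCivita I X (f • Y) p = mvfderiv I f p (X p) • Y p + f p • leviCivita I X Y p := by
  refine eq_of_forall_inner_field fun W hW ↦ ?_
  have h1 := mvfderiv_fun_mul (I := I) hf.mdifferentiableAt (hY.inner_field hW).mdifferentiableAt
  have h2 := mvfderiv_fun_mul (I := I) hf.mdifferentiableAt (hX.inner_field hY).mdifferentiableAt
  rw [inner_add_left, real_inner_smul_left, real_inner_smul_left,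
    hX.inner_leviCivita (hY.smul hf) hW, hX.inner_leviCivita hY hW]
  simp only [koszul, Pi.smul_apply', real_inner_smul_left, real_inner_smul_right,
    mlieBracket_smul_left hf.mdifferentiableAt hY.mdifferentiableAt,
    mlieBracket_smul_right hf.mdifferentiableAt hY.mdifferentiableAt, h1, h2]
  simp [inner_add_left, inner_smul_left, real_inner_comm]
  ring

theorem mvfderiv_congr (h : ∀ᶠ x in 𝓝 p, f x = g x) : mvfderiv I f p = mvfderiv I g p := by
  ext v
  exact congr($(Filter.EventuallyEq.mfderiv_eq (I := I) (I' := 𝓘(ℝ, ℝ)) h) v)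

theorem leviCivita_congr_right (h : ∀ᶠ x in 𝓝 p, Y x = Z x) :
    leviCivita I X Y p = leviCivita I X Z p := by
  unfold leviCivita
  refine Finset.sum_congr rfl fun i _ ↦ ?_
  congr 1
  set W := extendVector I (orthoFrame I p i)
  have h1 : mvfderiv I (fun x ↦ (inner ℝ (Y x) (W x) : ℝ)) p
      = mvfderiv I (fun x ↦ inner ℝ (Z x) (W x)) p :=
    mvfderiv_congr (h.mono fun x hx ↦ by simp only [hx])
  have h2 : mvfderiv I (fun x ↦ (inner ℝ (X x) (Y x) : ℝ)) p
      = mvfderiv I (fun x ↦ inner ℝ (X x) (Z x)) p :=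
    mvfderiv_congr (h.mono fun x hx ↦ by simp only [hx])
  have h3 : mlieBracket I X Y p = mlieBracket I X Z p :=
    Filter.EventuallyEq.mlieBracket_vectorField_eq (Filter.EventuallyEq.refl _ _) h
  have h4 : mlieBracket I Y W p = mlieBracket I Z W p :=
    Filter.EventuallyEq.mlieBracket_vectorField_eq h (Filter.EventuallyEq.refl _ _)
  simp only [koszul, h1, h2, h3, h4, h.self_of_nhds]

theorem mvfderiv_inner_comm : mvfderiv I (fun x ↦ (inner ℝ (X x) (Y x) : ℝ)) p
    = mvfderiv I (fun x ↦ (inner ℝ (Y x) (X x) : ℝ)) p := by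
  simp only [real_inner_comm]

/-- The Levi-Civita connection has no torsion. -/
theorem leviCivita_sub_leviCivita (hX : SmoothNear I X p) (hY : SmoothNear I Y p) :
    leviCivita I X Y p - leviCivita I Y X p = mlieBracket I X Y p := by
  refine eq_of_forall_inner_field fun W hW ↦ ?_
  rw [inner_sub_left, hX.inner_leviCivita hY hW, hY.inner_leviCivita hX hW]
  unfold koszul
  rw [mvfderiv_inner_comm (X := Y) (Y := W), mvfderiv_inner_comm (X := W) (Y := X),
    mvfderiv_inner_comm (X := Y) (Y := X), mlieBracket_swap_apply (V := Y) (W := X),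
    mlieBracket_swap_apply (V := W) (W := Y), mlieBracket_swap_apply (V := X) (W := W)]
  simp only [inner_neg_left]
  ring

/-- The Levi-Civita connection is compatible with the metric. -/
theorem mvfderiv_inner (hX : SmoothNear I X p) (hY : SmoothNear I Y p) (hZ : SmoothNear I Z p) :
    mvfderiv I (fun x ↦ (inner ℝ (Y x) (Z x) : ℝ)) p (X p)
      = inner ℝ (leviCivita I X Y p) (Z p) + inner ℝ (Y p) (leviCivita I X Z p) := by
  rw [real_inner_comm (leviCivita I X Z p), hX.inner_leviCivita hY hZ, hX.inner_leviCivita hZ hY]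
  unfold koszul
  rw [mvfderiv_inner_comm (X := Z) (Y := Y), mvfderiv_inner_comm (X := Z) (Y := X),
    mvfderiv_inner_comm (X := Y) (Y := X), mlieBracket_swap_apply (V := Z) (W := Y),
    mlieBracket_swap_apply (V := Z) (W := X), mlieBracket_swap_apply (V := Y) (W := X)]
  simp only [inner_neg_left]
  ring

theorem smoothNear_leviCivita (hX : SmoothNear I X p) (hY : SmoothNear I Y p) :
    SmoothNear I (leviCivita I X Y) p := by
  refine smoothNear_of_inner fun Z hZ ↦ ?_
  have hk : SmoothFunNear I (fun x ↦ koszul I X Y Z x) p := by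
    unfold koszul
    refine (smoothFunNear_const _).mul ?_
    exact (((((smoothFunNear_mvfderiv (hY.inner_field hZ) hX).add
      (smoothFunNear_mvfderiv (hZ.inner_field hX) hY)).sub
      (smoothFunNear_mvfderiv (hX.inner_field hY) hZ)).add
      ((smoothNear_mlieBracket hX hY).inner_field hZ)).sub
      ((smoothNear_mlieBracket hY hZ).inner_field hX)).add
      ((smoothNear_mlieBracket hZ hX).inner_field hY)
  refine hk.congr ?_
  filter_upwards [hX.eventually, hY.eventually, hZ.eventually] with x h h' h''
  rw [real_inner_comm, h.inner_leviCivita h' h'']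

theorem germTensorial_leviCivita_left (hY : SmoothNear I Y p) :
    GermTensorial I (fun X ↦ leviCivita I X Y p) p where
  smul hf hX := leviCivita_smul_left hf hX hY
  add hX hX' := leviCivita_add_left hX hX' hY

theorem leviCivita_congr_left {X' : Π x : M, TangentSpace I x} (hX : SmoothNear I X p)
    (hX' : SmoothNear I X' p) (hY : SmoothNear I Y p) (h : X p = X' p) :
    leviCivita I X Y p = leviCivita I X' Y p :=
  (germTensorial_leviCivita_left hY).pointwise hX hX' h

theorem leviCivita_const_smul_right (c : ℝ) (hX : SmoothNear I X p) (hY : SmoothNear I Y p) :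
    leviCivita I X (c • Y) p = c • leviCivita I X Y p := by
  have := leviCivita_smul_right (smoothFunNear_const c) hX hY
  rw [mvfderiv_const] at this
  simpa using! this

theorem leviCivita_neg_right (hX : SmoothNear I X p) (hY : SmoothNear I Y p) :
    leviCivita I X (-Y) p = -leviCivita I X Y p := by
  simpa using leviCivita_const_smul_right (-1) hX hY

theorem leviCivita_sub_right (hX : SmoothNear I X p) (hY : SmoothNear I Y p)
    (hZ : SmoothNear I Z p) :
    leviCivita I X (Y - Z) p = leviCivita I X Y p - leviCivita I X Z p := by
  rw [sub_eq_add_neg, leviCivita_add_right hX hY hZ.neg, leviCivita_neg_right hX hZ, sub_eq_add_neg]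

theorem jacobi_mlieBracket (hX : SmoothNear I X p) (hY : SmoothNear I Y p)
    (hZ : SmoothNear I Z p) :
    mlieBracket I X (mlieBracket I Y Z) p = mlieBracket I (mlieBracket I X Y) Z p
      + mlieBracket I Y (mlieBracket I X Z) p := by
  have hm3 : IsManifold I (minSmoothness ℝ 3) M := by
    rw [minSmoothness_of_isRCLikeNormedField]; infer_instance
  have hle : minSmoothness ℝ 2 ≤ ∞ := by
    rw [minSmoothness_of_isRCLikeNormedField]; exact ENat.LEInfty.out
  exact leibniz_identity_mlieBracket_apply (hX.smoothFieldAt.of_le hle)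
    (hY.smoothFieldAt.of_le hle) (hZ.smoothFieldAt.of_le hle)

/-- The Lie bracket of vector fields is the commutator of derivations. It suffices to test this on
`f Z` for a field `Z` with `Z p ≠ 0`, where it is the Jacobi identity. -/
theorem mvfderiv_mlieBracket (hf : SmoothFunNear I f p) (hX : SmoothNear I X p)
    (hY : SmoothNear I Y p) :
    mvfderiv I f p (mlieBracket I X Y p)
      = mvfderiv I (fun x ↦ mvfderiv I f x (Y x)) p (X p)
        - mvfderiv I (fun x ↦ mvfderiv I f x (X x)) p (Y p) := by
  by_cases hE : ∀ v : TangentSpace I p, v = 0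
  · rw [hE (mlieBracket I X Y p), hE (X p), hE (Y p)]
    simp
  push Not at hE
  obtain ⟨v, hv⟩ := hE
  set Z := extendVector I v with hZdef
  have hZ : SmoothNear I Z p := smoothNear_extendVector v
  have hZp : Z p = v := extendVector_self v
  have expand : ∀ A B : Π x : M, TangentSpace I x, SmoothNear I A p → SmoothNear I B p →
      mlieBracket I A (mlieBracket I B (f • Z)) p
        = mvfderiv I (fun x ↦ mvfderiv I f x (B x)) p (A p) • Z p
          + mvfderiv I f p (B p) • mlieBracket I A Z p
          + (mvfderiv I f p (A p) • mlieBracket I B Z p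
          + f p • mlieBracket I A (mlieBracket I B Z) p) := by
    intro A B hA hB
    have h1 : ∀ᶠ x in 𝓝 p, mlieBracket I B (f • Z) x
        = ((fun x ↦ mvfderiv I f x (B x)) • Z + f • mlieBracket I B Z) x := by
      filter_upwards [hf.eventually, hZ.eventually] with x h h'
      rw [mlieBracket_smul_right h.mdifferentiableAt h'.mdifferentiableAt]
      rfl
    have hs := smoothFunNear_mvfderiv hf hB
    have hBZ := smoothNear_mlieBracket hB hZ
    refine (Filter.EventuallyEq.mlieBracket_vectorField_eq (V := A)
      (Filter.EventuallyEq.refl _ _) h1).trans ?_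
    rw [mlieBracket_add_right (hZ.smul hs).mdifferentiableAt (hBZ.smul hf).mdifferentiableAt,
      mlieBracket_smul_right hs.mdifferentiableAt hZ.mdifferentiableAt,
      mlieBracket_smul_right hf.mdifferentiableAt hBZ.mdifferentiableAt]
  have hj := jacobi_mlieBracket hX hY (hZ.smul hf)
  rw [expand X Y hX hY, expand Y X hY hX, mlieBracket_smul_right hf.mdifferentiableAt
    hZ.mdifferentiableAt, jacobi_mlieBracket hX hY hZ, hZp] at hj
  have : (mvfderiv I f p (mlieBracket I X Y p)
      - (mvfderiv I (fun x ↦ mvfderiv I f x (Y x)) p (X p)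
        - mvfderiv I (fun x ↦ mvfderiv I f x (X x)) p (Y p))) • v = 0 := by
    rw [← sub_eq_zero] at hj
    rw [← neg_eq_zero, ← hj]
    module
  exact sub_eq_zero.1 ((smul_eq_zero.1 this).resolve_right hv)

end LeviCivita

/-! ### The curvature tensor -/

section Curvature

variable {E : Type*} [NormedAddCommGroup E] [NormedSpace ℝ E] [FiniteDimensional ℝ E]
  {H : Type*} [TopologicalSpace H] {I : ModelWithCorners ℝ E H}
  {M : Type*} [TopologicalSpace M] [ChartedSpace H M] [IsManifold I ∞ M]
  [RiemannianBundle (fun x : M ↦ TangentSpace I x)]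
  [IsContMDiffRiemannianBundle I ∞ E (fun x : M ↦ TangentSpace I x)]
  {p : M} {X Y Z W : Π x : M, TangentSpace I x} {f g : M → ℝ}

theorem leviCivita_eventually_add_right (hX : SmoothNear I X p) (hY : SmoothNear I Y p)
    (hZ : SmoothNear I Z p) :
    ∀ᶠ x in 𝓝 p, leviCivita I X (Y + Z) x = (leviCivita I X Y + leviCivita I X Z) x := by
  filter_upwards [hX.eventually, hY.eventually, hZ.eventually] with x h h' h''
  exact leviCivita_add_right h h' h''

theorem leviCivita_leviCivita_add (hX : SmoothNear I X p) (hY : SmoothNear I Y p)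
    (hZ : SmoothNear I Z p) (hW : SmoothNear I W p) :
    leviCivita I X (leviCivita I Y (Z + W)) p
      = leviCivita I X (leviCivita I Y Z) p + leviCivita I X (leviCivita I Y W) p := by
  rw [leviCivita_congr_right (leviCivita_eventually_add_right hY hZ hW),
    leviCivita_add_right hX (smoothNear_leviCivita hY hZ) (smoothNear_leviCivita hY hW)]

theorem leviCivita_leviCivita_smul (hf : SmoothFunNear I f p) (hX : SmoothNear I X p)
    (hY : SmoothNear I Y p) (hZ : SmoothNear I Z p) :
    leviCivita I X (leviCivita I Y (f • Z)) p
      = mvfderiv I (fun x ↦ mvfderiv I f x (Y x)) p (X p) • Z p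
        + mvfderiv I f p (Y p) • leviCivita I X Z p
        + (mvfderiv I f p (X p) • leviCivita I Y Z p
        + f p • leviCivita I X (leviCivita I Y Z) p) := by
  have h1 : ∀ᶠ x in 𝓝 p, leviCivita I Y (f • Z) x
      = ((fun x ↦ mvfderiv I f x (Y x)) • Z + f • leviCivita I Y Z) x := by
    filter_upwards [hf.eventually, hY.eventually, hZ.eventually] with x h h' h''
    exact leviCivita_smul_right h h' h''
  have hs := smoothFunNear_mvfderiv hf hY
  have hYZ := smoothNear_leviCivita hY hZ
  rw [leviCivita_congr_right h1, leviCivita_add_right hX (hZ.smul hs) (hYZ.smul hf),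
    leviCivita_smul_right hs hX hZ, leviCivita_smul_right hf hX hYZ]

theorem germTensorial_curvatureField_right (hX : SmoothNear I X p) (hY : SmoothNear I Y p) :
    GermTensorial I (fun Z ↦ curvatureField I X Y Z p) p where
  smul {f Z} hf hZ := by
    unfold curvatureField
    rw [leviCivita_leviCivita_smul hf hX hY hZ, leviCivita_leviCivita_smul hf hY hX hZ,
      leviCivita_smul_right hf (smoothNear_mlieBracket hX hY) hZ, mvfderiv_mlieBracket hf hX hY]
    module
  add {Z W} hZ hW := by
    unfold curvatureField
    rw [leviCivita_leviCivita_add hX hY hZ hW, leviCivita_leviCivita_add hY hX hZ hW,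
      leviCivita_add_right (smoothNear_mlieBracket hX hY) hZ hW]
    module

theorem curvatureField_swap (hX : SmoothNear I X p) (hY : SmoothNear I Y p)
    (hZ : SmoothNear I Z p) : curvatureField I X Y Z p = -curvatureField I Y X Z p := by
  unfold curvatureField
  have h1 : leviCivita I (mlieBracket I X Y) Z p = -leviCivita I (mlieBracket I Y X) Z p := by
    have h := leviCivita_smul_left (smoothFunNear_const (-1)) (smoothNear_mlieBracket hY hX) hZ
    rw [leviCivita_congr_left (smoothNear_mlieBracket hX hY)
      ((smoothNear_mlieBracket hY hX).smul (smoothFunNear_const (-1))) hZ ?_, h, neg_one_smul]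
    rw [mlieBracket_swap_apply]
    simp
  rw [h1]
  module

theorem germTensorial_curvatureField_left (hY : SmoothNear I Y p) (hZ : SmoothNear I Z p) :
    GermTensorial I (fun X ↦ curvatureField I X Y Z p) p where
  smul {f X} hf hX := by
    unfold curvatureField
    have h1 : ∀ᶠ x in 𝓝 p, leviCivita I (f • X) Z x = (f • leviCivita I X Z) x := by
      filter_upwards [hf.eventually, hX.eventually, hZ.eventually] with x h h' h''
      exact leviCivita_smul_left h h' h''
    have hb := smoothNear_mlieBracket hX hY
    have hd : SmoothFunNear I (fun x ↦ 0 - mvfderiv I f x (Y x)) p :=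
      (smoothFunNear_const 0).sub (smoothFunNear_mvfderiv hf hY)
    have h2 : leviCivita I (mlieBracket I (f • X) Y) Z p
        = -mvfderiv I f p (Y p) • leviCivita I X Z p
          + f p • leviCivita I (mlieBracket I X Y) Z p := by
      rw [leviCivita_congr_left (smoothNear_mlieBracket (hX.smul hf) hY)
        ((hX.smul hd).add (hb.smul hf)) hZ ?_, leviCivita_add_left (hX.smul hd) (hb.smul hf) hZ,
        leviCivita_smul_left hd hX hZ, leviCivita_smul_left hf hb hZ, zero_sub]
      rw [mlieBracket_smul_left hf.mdifferentiableAt hX.mdifferentiableAt]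
      simp
    rw [leviCivita_smul_left hf hX (smoothNear_leviCivita hY hZ), leviCivita_congr_right h1,
      leviCivita_smul_right hf hY (smoothNear_leviCivita hX hZ), h2]
    module
  add {X X'} hX hX' := by
    unfold curvatureField
    have h1 : ∀ᶠ x in 𝓝 p, leviCivita I (X + X') Z x
        = (leviCivita I X Z + leviCivita I X' Z) x := by
      filter_upwards [hX.eventually, hX'.eventually, hZ.eventually] with x h h' h''
      exact leviCivita_add_left h h' h''
    have hb := smoothNear_mlieBracket hX hY
    have hb' := smoothNear_mlieBracket hX' hY
    have h2 : leviCivita I (mlieBracket I (X + X') Y) Z p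
        = leviCivita I (mlieBracket I X Y) Z p + leviCivita I (mlieBracket I X' Y) Z p := by
      rw [leviCivita_congr_left (smoothNear_mlieBracket (hX.add hX') hY) (hb.add hb') hZ
        (mlieBracket_add_left hX.mdifferentiableAt hX'.mdifferentiableAt),
        leviCivita_add_left hb hb' hZ]
    rw [leviCivita_add_left hX hX' (smoothNear_leviCivita hY hZ), leviCivita_congr_right h1,
      leviCivita_add_right hY (smoothNear_leviCivita hX hZ) (smoothNear_leviCivita hX' hZ), h2]
    module

theorem germTensorial_curvatureField_middle (hX : SmoothNear I X p) (hZ : SmoothNear I Z p) :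
    GermTensorial I (fun Y ↦ curvatureField I X Y Z p) p where
  smul {f Y} hf hY := by
    rw [curvatureField_swap hX (hY.smul hf) hZ, curvatureField_swap hX hY hZ, smul_neg,
      (germTensorial_curvatureField_left hX hZ).smul hf hY]
  add {Y Y'} hY hY' := by
    rw [curvatureField_swap hX (hY.add hY') hZ, curvatureField_swap hX hY hZ,
      curvatureField_swap hX hY' hZ, (germTensorial_curvatureField_left hX hZ).add hY hY', neg_add]

theorem curvatureField_eq_curvature (hX : SmoothNear I X p) (hY : SmoothNear I Y p)
    (hZ : SmoothNear I Z p) : curvatureField I X Y Z p = curvature I p (X p) (Y p) (Z p) := by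
  have hX' := smoothNear_extendVector (X p)
  have hY' := smoothNear_extendVector (Y p)
  have hZ' := smoothNear_extendVector (Z p)
  rw [(germTensorial_curvatureField_left hY hZ).pointwise hX hX' (by simp),
    (germTensorial_curvatureField_middle hX' hZ).pointwise hY hY' (by simp),
    (germTensorial_curvatureField_right hX' hY').pointwise hZ hZ' (by simp)]
  rfl

variable (I) in
/-- The curvature tensor at `p` as a trilinear map. -/
def curvatureHom (p : M) :
    TangentSpace I p →ₗ[ℝ] TangentSpace I p →ₗ[ℝ] TangentSpace I p →ₗ[ℝ] TangentSpace I p :=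
  LinearMap.mk₂ ℝ
    (fun u v ↦ (germTensorial_curvatureField_right (smoothNear_extendVector u)
      (smoothNear_extendVector v)).toLinearMap _)
    (fun u u' v ↦ LinearMap.ext fun w ↦
      ((germTensorial_curvatureField_left (smoothNear_extendVector v)
        (smoothNear_extendVector w)).toLinearMap _).map_add u u')
    (fun c u v ↦ LinearMap.ext fun w ↦
      ((germTensorial_curvatureField_left (smoothNear_extendVector v)
        (smoothNear_extendVector w)).toLinearMap _).map_smul c u)
    (fun u v v' ↦ LinearMap.ext fun w ↦
      ((germTensorial_curvatureField_middle (smoothNear_extendVector u)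
        (smoothNear_extendVector w)).toLinearMap _).map_add v v')
    (fun c u v ↦ LinearMap.ext fun w ↦
      ((germTensorial_curvatureField_middle (smoothNear_extendVector u)
        (smoothNear_extendVector w)).toLinearMap _).map_smul c v)

theorem curvature_swap (u v w : TangentSpace I p) :
    curvature I p u v w = -curvature I p v u w :=
  curvatureField_swap (smoothNear_extendVector u) (smoothNear_extendVector v)
    (smoothNear_extendVector w)

/-- The first Bianchi identity. -/
theorem curvature_bianchi (u v w : TangentSpace I p) :
    curvature I p u v w + curvature I p v w u + curvature I p w u v = 0 := by
  have hX := smoothNear_extendVector u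
  have hY := smoothNear_extendVector v
  have hZ := smoothNear_extendVector w
  unfold curvature curvatureField
  set X := extendVector I u
  set Y := extendVector I v
  set Z := extendVector I w
  have key : ∀ A B C : Π x : M, TangentSpace I x, SmoothNear I A p → SmoothNear I B p →
      SmoothNear I C p → leviCivita I A (leviCivita I B C) p - leviCivita I A (leviCivita I C B) p
        - leviCivita I (mlieBracket I B C) A p = mlieBracket I A (mlieBracket I B C) p := by
    intro A B C hA hB hC
    have h1 : ∀ᶠ x in 𝓝 p, (leviCivita I B C - leviCivita I C B) x = mlieBracket I B C x := by
      filter_upwards [hB.eventually, hC.eventually] with x h h'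
      exact leviCivita_sub_leviCivita h h'
    rw [← leviCivita_sub_right hA (smoothNear_leviCivita hB hC) (smoothNear_leviCivita hC hB),
      leviCivita_congr_right h1, leviCivita_sub_leviCivita hA (smoothNear_mlieBracket hB hC)]
  have h1 := key X Y Z hX hY hZ
  have h2 := key Y Z X hY hZ hX
  have h3 := key Z X Y hZ hX hY
  have hsum : mlieBracket I X (mlieBracket I Y Z) p + mlieBracket I Y (mlieBracket I Z X) p
      + mlieBracket I Z (mlieBracket I X Y) p = 0 := by
    have h4 : mlieBracket I Y (mlieBracket I Z X) p = -mlieBracket I Y (mlieBracket I X Z) p := by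
      rw [mlieBracket_swap (V := Z) (W := X)]
      have := mlieBracket_const_smul_right (I := I) (V := Y) (c := (-1 : ℝ))
        (smoothNear_mlieBracket hX hZ).mdifferentiableAt
      simpa using this
    rw [jacobi_mlieBracket hX hY hZ, h4, mlieBracket_swap_apply (V := mlieBracket I X Y) (W := Z)]
    abel
  rw [← hsum, ← h1, ← h2, ← h3]
  abel

/-- The curvature endomorphism `R(u,v)` is skew-symmetric. -/
theorem inner_curvature (u v w z : TangentSpace I p) :
    (inner ℝ (curvature I p u v w) z : ℝ) = -inner ℝ w (curvature I p u v z) := by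
  have hX := smoothNear_extendVector u
  have hY := smoothNear_extendVector v
  have hZ := smoothNear_extendVector w
  have hW := smoothNear_extendVector z
  have hZp := extendVector_self w
  have hWp := extendVector_self z
  unfold curvature curvatureField
  set X := extendVector I u
  set Y := extendVector I v
  set Z := extendVector I w
  set W := extendVector I z
  have key : ∀ A B : Π x : M, TangentSpace I x, SmoothNear I A p → SmoothNear I B p →
      mvfderiv I (fun x ↦ mvfderiv I (fun y ↦ (inner ℝ (Z y) (W y) : ℝ)) x (B x)) p (A p)
        = inner ℝ (leviCivita I A (leviCivita I B Z) p) (W p)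
          + inner ℝ (leviCivita I B Z p) (leviCivita I A W p)
          + (inner ℝ (leviCivita I A Z p) (leviCivita I B W p)
          + inner ℝ (Z p) (leviCivita I A (leviCivita I B W) p)) := by
    intro A B hA hB
    have h1 : ∀ᶠ x in 𝓝 p, mvfderiv I (fun y ↦ (inner ℝ (Z y) (W y) : ℝ)) x (B x)
        = inner ℝ (leviCivita I B Z x) (W x) + inner ℝ (Z x) (leviCivita I B W x) := by
      filter_upwards [hB.eventually, hZ.eventually, hW.eventually] with x h h' h''
      exact mvfderiv_inner h h' h''
    have hBZ := smoothNear_leviCivita hB hZ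
    have hBW := smoothNear_leviCivita hB hW
    rw [mvfderiv_congr h1, mvfderiv_fun_add (hBZ.inner_field hW).mdifferentiableAt
      (hZ.inner_field hBW).mdifferentiableAt, add_apply,
      mvfderiv_inner hA hBZ hW, mvfderiv_inner hA hZ hBW]
  have h1 := mvfderiv_mlieBracket (hZ.inner_field hW) hX hY
  rw [key X Y hX hY, key Y X hY hX, mvfderiv_inner (smoothNear_mlieBracket hX hY) hZ hW, hZp, hWp]
    at h1
  simp only [inner_sub_left, inner_sub_right]
  linarith

end Curvature

/-! ### Algebra of almost `α`-cosymplectic structures on a tangent space -/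

section PointwiseAlgebra

variable {V : Type*} [NormedAddCommGroup V] [InnerProductSpace ℝ V]

/-- The algebraic relations on a tangent space between the Reeb vector `ξ`, the endomorphism `φ` and
`B = ∇ξ` of an almost `α`-cosymplectic structure; the form `η` is `⟪ξ, ·⟫`. -/
structure ReebAlgebra (α : ℝ) (ξ : V) (φ B : V →ₗ[ℝ] V) : Prop where
  inner_xi : (inner ℝ ξ ξ : ℝ) = 1
  phi_phi : ∀ v, φ (φ v) = -v + (inner ℝ ξ v : ℝ) • ξ
  phi_xi : φ ξ = 0
  phi_skew : ∀ u v, (inner ℝ (φ u) v : ℝ) = -inner ℝ u (φ v)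
  B_symm : ∀ u v, (inner ℝ (B u) v : ℝ) = inner ℝ u (B v)
  B_xi : B ξ = 0
  B_phi : ∀ v, B (φ v) = (2 * α) • φ v - φ (B v)

namespace ReebAlgebra

variable {α κ μ ν : ℝ} {ξ : V} {φ B : V →ₗ[ℝ] V}

theorem inner_phi (h : ReebAlgebra α ξ φ B) (v : V) : (inner ℝ ξ (φ v) : ℝ) = 0 := by
  have := h.phi_skew ξ v
  rw [h.phi_xi, inner_zero_left] at this
  linarith

theorem inner_B (h : ReebAlgebra α ξ φ B) (v : V) : (inner ℝ ξ (B v) : ℝ) = 0 := by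
  rw [← h.B_symm, h.B_xi, inner_zero_left]

/-- If `φ x` vanishes and `x` is orthogonal to `ξ`, then `x = 0`. -/
theorem eq_zero_of_phi (h : ReebAlgebra α ξ φ B) {x : V} (h1 : φ x = 0)
    (h2 : (inner ℝ ξ x : ℝ) = 0) : x = 0 := by
  have := h.phi_phi x
  rw [h1, map_zero, h2, zero_smul, add_zero] at this
  exact neg_eq_zero.1 this.symm

end ReebAlgebra

/-- `dΦ = 2α η ∧ Φ`, contracted with `ξ`, says `∇_ξφ + φB + Bφ = 2αφ`. Differentiating `φ²` shows
that `∇_ξφ` anticommutes with `φ`, whereas `φB + Bφ - 2αφ` commutes with it; so both vanish.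
Here `F u v` stands for `(∇_u φ) v`. -/
theorem nablaXiPhi_eq_zero_and_anticommute {α : ℝ} {ξ : V} {φ B : V →ₗ[ℝ] V} {F : V → V → V}
    (inner_xi : (inner ℝ ξ ξ : ℝ) = 1)
    (phi_phi : ∀ v, φ (φ v) = -v + (inner ℝ ξ v : ℝ) • ξ)
    (phi_xi : φ ξ = 0)
    (phi_skew : ∀ u v, (inner ℝ (φ u) v : ℝ) = -inner ℝ u (φ v))
    (B_symm : ∀ u v, (inner ℝ (B u) v : ℝ) = inner ℝ u (B v))
    (B_xi : B ξ = 0)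
    (hF_skew : ∀ u v w, (inner ℝ (F u v) w : ℝ) = -inner ℝ v (F u w))
    (hF_xi : ∀ u, F u ξ = -φ (B u))
    (hF_phi : ∀ u v, F u (φ v) + φ (F u v) = (inner ℝ (B u) v : ℝ) • ξ + (inner ℝ ξ v : ℝ) • B u)
    (hcyc : ∀ u v w, (inner ℝ (F u v) w + inner ℝ (F v w) u + inner ℝ (F w u) v : ℝ)
      = 2 * α * (inner ℝ ξ u * inner ℝ (φ v) w + inner ℝ ξ v * inner ℝ (φ w) u
        + inner ℝ ξ w * inner ℝ (φ u) v)) :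
    (∀ v, F ξ v = 0) ∧ ∀ v, B (φ v) = (2 * α) • φ v - φ (B v) := by
  have inner_phi : ∀ v, (inner ℝ ξ (φ v) : ℝ) = 0 := fun v ↦ by
    have := phi_skew ξ v
    rw [phi_xi, inner_zero_left] at this
    linarith
  have inner_B : ∀ v, (inner ℝ ξ (B v) : ℝ) = 0 := fun v ↦ by
    rw [← B_symm, B_xi, inner_zero_left]
  have E1 : ∀ v, F ξ v = (2 * α) • φ v - φ (B v) - B (φ v) := by
    intro v
    refine ext_inner_right ℝ fun w ↦ ?_
    have h1 := hcyc ξ v w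
    have h2 : (inner ℝ (F v w) ξ : ℝ) = inner ℝ (φ (B v)) w := by
      rw [hF_skew, hF_xi, inner_neg_right, neg_neg, real_inner_comm]
    have h3 : (inner ℝ (F w ξ) v : ℝ) = inner ℝ (B (φ v)) w := by
      rw [hF_xi, inner_neg_left, phi_skew, neg_neg, B_symm, real_inner_comm]
    rw [h2, h3, inner_xi, phi_xi, inner_zero_left, real_inner_comm ξ (φ w), inner_phi] at h1
    simp only [inner_sub_left, real_inner_smul_left]
    linarith
  have E2 : ∀ v, φ (F ξ v) = 0 := by
    intro v
    have h1 := hF_phi ξ v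
    rw [B_xi, inner_zero_left, zero_smul, smul_zero, add_zero, E1 (φ v)] at h1
    have h2 : φ (F ξ v) = (2 * α) • φ (φ v) - φ (B (φ v)) - B (φ (φ v)) := by
      rw [E1 v, map_sub, map_sub, map_smul, phi_phi (B v), phi_phi v, map_add, map_neg, map_smul,
        B_xi, inner_B]
      module
    rw [← h2, ← two_smul ℝ] at h1
    exact (smul_eq_zero.1 h1).resolve_left two_ne_zero
  have E3 : ∀ v, F ξ v = 0 := by
    intro v
    have h1 := phi_phi (F ξ v)
    have h2 : (inner ℝ ξ (F ξ v) : ℝ) = 0 := by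
      rw [real_inner_comm, hF_skew, hF_xi, B_xi, map_zero, neg_zero, inner_zero_right, neg_zero]
    rw [E2, map_zero, h2, zero_smul, add_zero] at h1
    exact neg_eq_zero.1 h1.symm
  refine ⟨E3, fun v ↦ ?_⟩
  have := E1 v
  rw [E3] at this
  exact (sub_eq_zero.1 this.symm).symm

namespace ReebAlgebra

variable {α κ μ ν : ℝ} {ξ : V} {φ B : V →ₗ[ℝ] V}

/-- The part of `R(·,ξ)ξ = κ + μh + νφh` that commutes with `φ` determines `B² - 2αB`; in terms of
`h` this is `h² = (κ + α²)φ²`. Here `L` stands for `∇_ξ B`, which anticommutes with `φ`. -/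
theorem B_B (h : ReebAlgebra α ξ φ B) {L : V → V}
    (hL : ∀ v, L (φ v) = -φ (L v))
    (hnull : ∀ v, -B (B v) - L v = κ • (v - (inner ℝ ξ v : ℝ) • ξ)
      + μ • (φ (B v) - α • φ v) + ν • φ (φ (B v) - α • φ v)) (v : V) :
    B (B v) = (2 * α) • B v - (κ + 2 * α ^ 2) • (v - (inner ℝ ξ v : ℝ) • ξ) := by
  set x := B (B v) - (2 * α) • B v + (κ + 2 * α ^ 2) • (v - (inner ℝ ξ v : ℝ) • ξ) with hx
  have h1 : φ x = 0 := by
    have e1 := congrArg φ (hnull v)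
    have e2 := hnull (φ v)
    rw [hL] at e2
    simp only [map_add, map_sub, map_neg, map_smul, h.B_phi, h.phi_phi, h.phi_xi, h.inner_phi,
      h.inner_B, smul_zero, zero_smul, sub_zero, add_zero] at e1 e2
    have e3 := congrArg₂ (· + ·) e1 e2
    rw [← sub_eq_zero] at e3
    have e4 : (-2 : ℝ) • φ x = 0 := by
      rw [← e3, hx]
      simp only [map_add, map_sub, map_smul, h.phi_xi]
      module
    exact (smul_eq_zero.1 e4).resolve_left (by norm_num)
  have h2 : (inner ℝ ξ x : ℝ) = 0 := by
    rw [hx]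
    simp only [inner_add_right, inner_sub_right, real_inner_smul_right, h.inner_B, h.inner_xi]
    ring
  have h3 := h.eq_zero_of_phi h1 h2
  rw [← sub_eq_zero, ← h3, hx]
  module

end ReebAlgebra

end PointwiseAlgebra

/-! ### Integrability of `φ` on the leaves of `ker η` -/

section KaehlerLeaves

variable {V : Type*} [NormedAddCommGroup V] [InnerProductSpace ℝ V]
  {α κ : ℝ} {ξ : V} {φ B : V →ₗ[ℝ] V} {F D : V →ₗ[ℝ] V →ₗ[ℝ] V}

/-- The leaves of `ker η` are Kähler when `κ ≠ -α²`, at the level of a single tangent space.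
`F u v` and `D u v` stand for `(∇_u φ) v` and `(∇_u B) v`. The operator `S = α - B` on `ker η`
satisfies the Codazzi equation and `S² = -(κ + α²)` is a constant multiple of the identity, which
forces `∇S = 0`. As `φ` interchanges the two eigenspaces of `S`, the form
`(u, v, w) ↦ ⟪(∇_u φ) v, φ w⟫` on an eigenspace is symmetric in `u, v` and skew in `v, w`, so it
vanishes. -/
theorem ReebAlgebra.inner_nablaPhi_eq_zero (h : ReebAlgebra α ξ φ B) (hκ : κ ≠ -α ^ 2)
    (hB : ∀ v, B (B v) = (2 * α) • B v - (κ + 2 * α ^ 2) • (v - (inner ℝ ξ v : ℝ) • ξ))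
    (hF_skew : ∀ u v w, (inner ℝ (F u v) w : ℝ) = -inner ℝ v (F u w))
    (hF_phi : ∀ u v, F u (φ v) + φ (F u v) = (inner ℝ (B u) v : ℝ) • ξ + (inner ℝ ξ v : ℝ) • B u)
    (hcyc : ∀ u v w, (inner ℝ (F u v) w + inner ℝ (F v w) u + inner ℝ (F w u) v : ℝ)
      = 2 * α * (inner ℝ ξ u * inner ℝ (φ v) w + inner ℝ ξ v * inner ℝ (φ w) u
        + inner ℝ ξ w * inner ℝ (φ u) v))
    (hD_symm : ∀ u v w, (inner ℝ (D u v) w : ℝ) = inner ℝ v (D u w))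
    (hD_codazzi : ∀ u v, (inner ℝ ξ u : ℝ) = 0 → (inner ℝ ξ v : ℝ) = 0 → D u v = D v u)
    (hD_phi : ∀ u v, F u (B v) + φ (D u v) + (D u (φ v) + B (F u v)) = (2 * α) • F u v)
    (hD_B : ∀ u v w, (inner ℝ ξ u : ℝ) = 0 → (inner ℝ ξ v : ℝ) = 0 → (inner ℝ ξ w : ℝ) = 0 →
      (inner ℝ (D u (B v) + B (D u v) - (2 * α) • D u v) w : ℝ) = 0)
    {u v w : V} (hu : (inner ℝ ξ u : ℝ) = 0) (hv : (inner ℝ ξ v : ℝ) = 0)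
    (hw : (inner ℝ ξ w : ℝ) = 0) : (inner ℝ (F u v) w : ℝ) = 0 := by
  set c := -(κ + α ^ 2) with hc
  have hc0 : c ≠ 0 := fun hc0 ↦ hκ (by linarith)
  let S : V →ₗ[ℝ] V := α • LinearMap.id - B
  have S_def : ∀ x, S x = α • x - B x := fun x ↦ by simp [S]
  have S_perp : ∀ x, (inner ℝ ξ x : ℝ) = 0 → (inner ℝ ξ (S x) : ℝ) = 0 := fun x hx ↦ by
    rw [S_def, inner_sub_right, real_inner_smul_right, hx, h.inner_B]
    ring
  have S_S : ∀ x, (inner ℝ ξ x : ℝ) = 0 → S (S x) = c • x := fun x hx ↦ by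
    rw [S_def, S_def, map_sub, map_smul, hB, hx, hc]
    module
  have S_phi : ∀ x, S (φ x) = -φ (S x) := fun x ↦ by
    rw [S_def, S_def, h.B_phi, map_sub, map_smul]
    module
  have S_symm : ∀ x y, (inner ℝ (S x) y : ℝ) = inner ℝ x (S y) := fun x y ↦ by
    simp only [S_def, inner_sub_left, inner_sub_right, real_inner_smul_left,
      real_inner_smul_right, h.B_symm]
  -- `∇S = 0`: the form `⟪(∇_x S) y, z⟫` is totally symmetric, and `S` anticommutes through it.
  have hC : ∀ x y z, (inner ℝ ξ x : ℝ) = 0 → (inner ℝ ξ y : ℝ) = 0 → (inner ℝ ξ z : ℝ) = 0 →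
      (inner ℝ (D x y) z : ℝ) = 0 := by
    have anti : ∀ x y z, (inner ℝ ξ x : ℝ) = 0 → (inner ℝ ξ y : ℝ) = 0 → (inner ℝ ξ z : ℝ) = 0 →
        (inner ℝ (D x (S y)) z : ℝ) = -inner ℝ (D x y) (S z) := by
      intro x y z hx hy hz
      have := hD_B x y z hx hy hz
      simp only [S_def, map_sub, map_smul, inner_sub_left, inner_sub_right, inner_add_left,
        real_inner_smul_left, real_inner_smul_right, h.B_symm] at this ⊢
      linarith
    have s23 : ∀ x y z, (inner ℝ (D x y) z : ℝ) = inner ℝ (D x z) y := fun x y z ↦ by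
      rw [hD_symm, real_inner_comm]
    have hS : ∀ x y z, (inner ℝ ξ x : ℝ) = 0 → (inner ℝ ξ y : ℝ) = 0 → (inner ℝ ξ z : ℝ) = 0 →
        (inner ℝ (D (S x) y) z : ℝ) = 0 := by
      intro x y z hx hy hz
      have e1 : (inner ℝ (D (S x) y) z : ℝ) = -inner ℝ (D x y) (S z) := by
        rw [hD_codazzi _ _ (S_perp x hx) hy, anti y x z hy hx hz, hD_codazzi y x hy hx]
      have e2 : (inner ℝ (D (S x) y) z : ℝ) = inner ℝ (D x y) (S z) := by
        rw [s23, hD_codazzi _ _ (S_perp x hx) hz, anti z x y hz hx hy, hD_codazzi z x hz hx,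
          s23 x z, anti x y z hx hy hz, neg_neg]
      linarith
    intro x y z hx hy hz
    have := hS (S x) y z (S_perp x hx) hy hz
    rw [S_S x hx, map_smul, LinearMap.smul_apply, real_inner_smul_left] at this
    exact (mul_eq_zero.1 this).resolve_left hc0
  have phi_perp : ∀ x, (inner ℝ ξ (φ x) : ℝ) = 0 := h.inner_phi
  -- `S` anticommutes with `∇φ` as well, since it anticommutes with `φ` and `∇S = 0`.
  have anti : ∀ x y z, (inner ℝ ξ x : ℝ) = 0 → (inner ℝ ξ y : ℝ) = 0 → (inner ℝ ξ z : ℝ) = 0 →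
      (inner ℝ (F x (S y)) z : ℝ) = -inner ℝ (F x y) (S z) := by
    intro x y z hx hy hz
    have e := congrArg (fun t ↦ (inner ℝ t z : ℝ)) (hD_phi x y)
    have e1 : (inner ℝ (φ (D x y)) z : ℝ) = 0 := by
      rw [h.phi_skew, hC x y _ hx hy (phi_perp z), neg_zero]
    have e2 := hC x (φ y) z hx (phi_perp y) hz
    simp only [inner_add_left, real_inner_smul_left, e1, e2, h.B_symm] at e
    simp only [S_def, map_sub, map_smul, inner_sub_left, inner_sub_right, real_inner_smul_left,
      real_inner_smul_right]
    linarith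
  have swap : ∀ x y z, (inner ℝ (F x y) z : ℝ) = -inner ℝ (F x z) y := fun x y z ↦ by
    rw [hF_skew, real_inner_comm]
  -- components of `∇φ` whose last two arguments lie in the same eigenspace of `S`
  have eig0 : ∀ (t : ℝ) (x y z : V), t ≠ 0 → (inner ℝ ξ x : ℝ) = 0 → (inner ℝ ξ y : ℝ) = 0 →
      (inner ℝ ξ z : ℝ) = 0 → S y = t • y → S z = t • z → (inner ℝ (F x y) z : ℝ) = 0 := by
    intro t x y z ht hx hy hz hy' hz'
    have := anti x y z hx hy hz
    rw [hy', hz', map_smul, real_inner_smul_left, real_inner_smul_right] at this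
    have : t * (inner ℝ (F x y) z : ℝ) = 0 := by linarith
    exact (mul_eq_zero.1 this).resolve_left ht
  -- components of `∇φ` whose first two arguments lie in one eigenspace of `S` and the third in the
  -- other: for `z = φ e` this is the form symmetric in one pair of slots and skew in another
  have eig : ∀ (t : ℝ) (a b z : V), t ≠ 0 → (inner ℝ ξ a : ℝ) = 0 → (inner ℝ ξ b : ℝ) = 0 →
      (inner ℝ ξ z : ℝ) = 0 → S a = t • a → S b = t • b → S z = -t • z →
      (inner ℝ (F a b) z : ℝ) = 0 := by
    intro t a b z ht ha hb hz ha' hb' hz'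
    have sym : ∀ a b e, (inner ℝ ξ a : ℝ) = 0 → (inner ℝ ξ b : ℝ) = 0 → S a = t • a → S b = t • b →
        (inner ℝ (F a b) (φ e) : ℝ) = inner ℝ (F b a) (φ e) := by
      intro a b e ha hb ha' hb'
      have h1 := hcyc a b (φ e)
      rw [ha, hb, phi_perp, eig0 t (φ e) a b ht (phi_perp e) ha hb ha' hb', swap b (φ e) a] at h1
      linarith
    have skew : ∀ a b e, (inner ℝ ξ b : ℝ) = 0 → (inner ℝ ξ e : ℝ) = 0 →
        (inner ℝ (F a b) (φ e) : ℝ) = -inner ℝ (F a e) (φ b) := by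
      intro a b e hb he
      have h1 := congrArg (fun t ↦ (inner ℝ t e : ℝ)) (hF_phi a b)
      simp only [inner_add_left, real_inner_smul_left, he, hb, h.phi_skew] at h1
      have h2 := swap a (φ b) e
      linarith
    have he : S (φ z) = t • φ z := by
      rw [S_phi, hz', map_smul]
      module
    have hz2 : φ (φ z) = -z := by rw [h.phi_phi, hz, zero_smul, add_zero]
    have hp := phi_perp z
    have h1 : (inner ℝ (F a b) (φ (φ z)) : ℝ) = -inner ℝ (F a b) (φ (φ z)) := by
      calc (inner ℝ (F a b) (φ (φ z)) : ℝ) = inner ℝ (F b a) (φ (φ z)) := sym a b _ ha hb ha' hb'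
        _ = -inner ℝ (F b (φ z)) (φ a) := skew b a _ ha hp
        _ = -inner ℝ (F (φ z) b) (φ a) := by rw [sym b (φ z) a hb hp hb' he]
        _ = inner ℝ (F (φ z) a) (φ b) := by rw [skew (φ z) b a hb ha, neg_neg]
        _ = inner ℝ (F a (φ z)) (φ b) := sym (φ z) a b hp ha he ha'
        _ = -inner ℝ (F a b) (φ (φ z)) := skew a (φ z) b hp hb
    rw [hz2, inner_neg_right] at h1
    linarith
  rcases eq_or_ne u 0 with rfl | hu0
  · rw [map_zero, LinearMap.zero_apply, inner_zero_left]
  have hcpos : 0 < c := by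
    have h1 : (inner ℝ (S u) (S u) : ℝ) = c * inner ℝ u u := by
      rw [← S_symm, S_S u hu, real_inner_smul_left]
    have h2 : (0 : ℝ) < inner ℝ u u := real_inner_self_pos.2 hu0
    have h3 : (0 : ℝ) ≤ inner ℝ (S u) (S u) := real_inner_self_nonneg
    rw [h1] at h3
    exact lt_of_le_of_ne (nonneg_of_mul_nonneg_left h3 h2) hc0.symm
  obtain ⟨s, hs0, hs⟩ : ∃ s : ℝ, s ≠ 0 ∧ s * s = c :=
    ⟨√c, (Real.sqrt_pos.2 hcpos).ne', Real.mul_self_sqrt hcpos.le⟩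
  -- Decompose each vector into its components `S x ± s x` in the eigenspaces of `S`.
  have perp : ∀ (t : ℝ) x, (inner ℝ ξ x : ℝ) = 0 → (inner ℝ ξ (S x + t • x) : ℝ) = 0 :=
    fun t x hx ↦ by
      rw [inner_add_right, real_inner_smul_right, hx, S_perp x hx]
      ring
  have proj : ∀ (t : ℝ) x, t * t = c → (inner ℝ ξ x : ℝ) = 0 →
      S (S x + t • x) = t • (S x + t • x) := fun t x ht hx ↦ by
    rw [map_add, map_smul, S_S x hx, ← ht]
    module
  have split : ∀ x, (2 * s) • x = (S x + s • x) - (S x + (-s) • x) := fun x ↦ by module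
  have hs' : -s * -s = c := by rw [← hs]; ring
  have hns : -s ≠ 0 := neg_ne_zero.2 hs0
  have h2s : (2 * s) ≠ 0 := mul_ne_zero two_ne_zero hs0
  -- an arbitrary first argument `u` is split into eigenvectors, and `∇φ` is skew in the other two
  have mixed : ∀ (t : ℝ) y z, t ≠ 0 → (inner ℝ ξ y : ℝ) = 0 → (inner ℝ ξ z : ℝ) = 0 →
      t * t = c → S y = t • y → S z = -t • z → (inner ℝ (F u y) z : ℝ) = 0 := by
    intro t y z ht hy hz htc hy' hz'
    have htc' : -t * -t = c := by rw [← htc]; ring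
    have e1 := eig t (S u + t • u) y z ht (perp t u hu) hy hz (proj t u htc hu) hy' hz'
    have e2 := eig (-t) (S u + (-t) • u) z y (neg_ne_zero.2 ht) (perp (-t) u hu) hz hy
      (proj (-t) u htc' hu) hz' (by rw [neg_neg, hy'])
    rw [swap, neg_eq_zero] at e2
    have e3 : (2 * t) • u = (S u + t • u) - (S u + (-t) • u) := by module
    have e4 : (2 * t) * (inner ℝ (F u y) z : ℝ) = 0 := by
      rw [← real_inner_smul_left, ← LinearMap.smul_apply, ← map_smul, e3, map_sub,
        LinearMap.sub_apply, inner_sub_left, e1, e2, sub_zero]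
    exact (mul_eq_zero.1 e4).resolve_left (mul_ne_zero two_ne_zero ht)
  have hfin : (2 * s) * ((2 * s) * (inner ℝ (F u v) w : ℝ)) = 0 := by
    rw [← real_inner_smul_right, ← real_inner_smul_left, ← map_smul, split v, split w, map_sub,
      inner_sub_left, inner_sub_right, inner_sub_right,
      eig0 s u _ _ hs0 hu (perp s v hv) (perp s w hw) (proj s v hs hv) (proj s w hs hw),
      eig0 (-s) u _ _ hns hu (perp (-s) v hv) (perp (-s) w hw) (proj (-s) v hs' hv)
        (proj (-s) w hs' hw),
      mixed s _ _ hs0 (perp s v hv) (perp (-s) w hw) hs (proj s v hs hv) (proj (-s) w hs' hw),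
      mixed (-s) _ _ hns (perp (-s) v hv) (perp s w hw) hs' (proj (-s) v hs' hv)
        (by rw [neg_neg]; exact proj s w hs hw)]
    ring
  exact (mul_eq_zero.1 ((mul_eq_zero.1 hfin).resolve_left h2s)).resolve_left h2s

/-- In dimension at most three the leaves of `ker η` are at most two-dimensional, and every almost
Hermitian surface is Kähler. -/
theorem ReebAlgebra.inner_nablaPhi_eq_zero_of_finrank_le [FiniteDimensional ℝ V]
    (h : ReebAlgebra α ξ φ B)
    (hdim : Module.finrank ℝ V ≤ 3)
    (hF_skew : ∀ u v w, (inner ℝ (F u v) w : ℝ) = -inner ℝ v (F u w))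
    (hF_phi : ∀ u v, F u (φ v) + φ (F u v) = (inner ℝ (B u) v : ℝ) • ξ + (inner ℝ ξ v : ℝ) • B u)
    {u v w : V} (hv : (inner ℝ ξ v : ℝ) = 0)
    (hw : (inner ℝ ξ w : ℝ) = 0) : (inner ℝ (F u v) w : ℝ) = 0 := by
  have hvv : ∀ x, (inner ℝ (F u x) x : ℝ) = 0 := fun x ↦ by
    have := hF_skew u x x
    rw [real_inner_comm (F u x) x] at this
    linarith
  have hvφ : (inner ℝ (F u v) (φ v) : ℝ) = 0 := by
    have h1 := congrArg (fun t ↦ (inner ℝ t v : ℝ)) (hF_phi u v)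
    simp only [inner_add_left, real_inner_smul_left, hv, h.phi_skew] at h1
    have h2 := hF_skew u (φ v) v
    rw [real_inner_comm (F u v) (φ v)] at h2
    linarith
  by_contra hne
  -- The component of `F u v` orthogonal to `ξ` would be orthogonal to `v` and `φ v` as well.
  set x := F u v - (inner ℝ ξ (F u v) : ℝ) • ξ with hx
  have hx0 : x ≠ 0 := by
    intro h0
    have : (inner ℝ x w : ℝ) = inner ℝ (F u v) w := by
      rw [hx, inner_sub_left, real_inner_smul_left, hw]
      ring
    rw [h0, inner_zero_left] at this
    exact hne this.symm
  have hv0 : v ≠ 0 := by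
    rintro rfl
    rw [map_zero, inner_zero_left] at hne
    exact hne rfl
  have hφv0 : φ v ≠ 0 := fun h0 ↦ hv0 (h.eq_zero_of_phi h0 hv)
  have hξ0 : ξ ≠ 0 := by
    rintro rfl
    have := h.inner_xi
    rw [inner_zero_left] at this
    exact zero_ne_one this
  have hξx : (inner ℝ ξ x : ℝ) = 0 := by
    rw [hx, inner_sub_right, real_inner_smul_right, h.inner_xi]
    ring
  have hvx : (inner ℝ v x : ℝ) = 0 := by
    rw [hx, inner_sub_right, real_inner_smul_right, real_inner_comm, hvv, real_inner_comm ξ v, hv]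
    ring
  have hφx : (inner ℝ (φ v) x : ℝ) = 0 := by
    rw [hx, inner_sub_right, real_inner_smul_right, real_inner_comm, hvφ,
      real_inner_comm ξ (φ v), h.inner_phi]
    ring
  have hvφv : (inner ℝ v (φ v) : ℝ) = 0 := by
    have := h.phi_skew v v
    rw [real_inner_comm v (φ v)] at this
    linarith
  have hlt : ∀ i j, i < j → (inner ℝ (![ξ, v, φ v, x] i) (![ξ, v, φ v, x] j) : ℝ) = 0 := by
    intro i j hij
    fin_cases i <;> fin_cases j <;> first
      | exact absurd hij (by decide)
      | exact hv
      | exact h.inner_phi v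
      | exact hξx
      | exact hvφv
      | exact hvx
      | exact hφx
  have hli : LinearIndependent ℝ ![ξ, v, φ v, x] := by
    refine linearIndependent_of_ne_zero_of_inner_eq_zero (𝕜 := ℝ) (fun i ↦ ?_) fun i j hij ↦ ?_
    · fin_cases i <;> assumption
    · rcases lt_or_gt_of_ne hij with hij | hij
      · exact hlt i j hij
      · rw [real_inner_comm, hlt j i hij]
  have := hli.fintype_card_le_finrank
  rw [Fintype.card_fin] at this
  omega

/-- Once the leaves are Kähler, `(∇_u φ) v = ⟪φBu, v⟫ ξ - η(v) φBu`. -/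
theorem ReebAlgebra.nablaPhi_eq (h : ReebAlgebra α ξ φ B)
    (hF_skew : ∀ u v w, (inner ℝ (F u v) w : ℝ) = -inner ℝ v (F u w))
    (hF_xi : ∀ u, F u ξ = -φ (B u)) (hFξ : ∀ v, F ξ v = 0)
    (hF : ∀ u v w, (inner ℝ ξ u : ℝ) = 0 → (inner ℝ ξ v : ℝ) = 0 → (inner ℝ ξ w : ℝ) = 0 →
      (inner ℝ (F u v) w : ℝ) = 0) (u v : V) :
    F u v = (inner ℝ (φ (B u)) v : ℝ) • ξ - (inner ℝ ξ v : ℝ) • φ (B u) := by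
  refine ext_inner_right ℝ fun w ↦ ?_
  have perp : ∀ x : V, (inner ℝ ξ (x - (inner ℝ ξ x : ℝ) • ξ) : ℝ) = 0 := fun x ↦ by
    rw [inner_sub_right, real_inner_smul_right, h.inner_xi]
    ring
  have h1 := hF _ _ _ (perp u) (perp v) (perp w)
  have h2 : (inner ℝ (F u ξ) ξ : ℝ) = 0 := by
    rw [hF_xi, inner_neg_left, real_inner_comm, h.inner_phi, neg_zero]
  have h3 : (inner ℝ (F u v) ξ : ℝ) = inner ℝ (φ (B u)) v := by
    rw [hF_skew, hF_xi, inner_neg_right, neg_neg, real_inner_comm]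
  simp only [map_sub, map_smul, LinearMap.sub_apply, LinearMap.smul_apply, hFξ, smul_zero,
    sub_zero, inner_sub_left, inner_sub_right, real_inner_smul_left, real_inner_smul_right, h2,
    h3] at h1 ⊢
  rw [hF_xi, inner_neg_left] at h1
  linarith

end KaehlerLeaves

/-! ### The trace computation for the Ricci operator -/

section RicciAlgebra

variable {V : Type*} [NormedAddCommGroup V] [InnerProductSpace ℝ V]
  {ι : Type*} [Fintype ι] (e : OrthonormalBasis ι ℝ V)

theorem sum_inner_smul_map (A : V →ₗ[ℝ] V) (v : V) :
    ∑ i, (inner ℝ v (e i) : ℝ) • A (e i) = A v := by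
  conv_rhs => rw [← e.sum_repr' v]
  simp only [map_sum, map_smul, real_inner_comm]

/-- The contraction `∑ b(e_i, A e_i)` for a skew-symmetric `A`. -/
theorem sum_bilin_skew {W : Type*} [AddCommGroup W] [Module ℝ W] (b : V →ₗ[ℝ] V →ₗ[ℝ] W)
    {A : V →ₗ[ℝ] V} (hA : ∀ u v, (inner ℝ (A u) v : ℝ) = -inner ℝ u (A v)) :
    ∑ i, b (A (e i)) (e i) = -∑ i, b (e i) (A (e i)) := by
  have h1 : ∀ i, b (A (e i)) (e i) = ∑ j, (inner ℝ (e j) (A (e i)) : ℝ) • b (e j) (e i) :=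
    fun i ↦ by
      conv_lhs => rw [← e.sum_repr' (A (e i))]
      simp only [map_sum, map_smul, LinearMap.sum_apply, LinearMap.smul_apply]
  have h2 : ∀ i, b (e i) (A (e i)) = ∑ j, (inner ℝ (e j) (A (e i)) : ℝ) • b (e i) (e j) :=
    fun i ↦ by
      conv_lhs => rw [← e.sum_repr' (A (e i))]
      simp only [map_sum, map_smul]
  simp only [h1, h2]
  rw [Finset.sum_comm, ← Finset.sum_neg_distrib]
  refine Finset.sum_congr rfl fun i _ ↦ ?_
  rw [← Finset.sum_neg_distrib]
  refine Finset.sum_congr rfl fun j _ ↦ ?_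
  rw [← neg_smul, ← hA, real_inner_comm]

variable [FiniteDimensional ℝ V] {α κ μ ν : ℝ} {ξ : V} {φ B : V →ₗ[ℝ] V}

theorem ReebAlgebra.sum_inner_phi_B (h : ReebAlgebra α ξ φ B) :
    ∑ i, (inner ℝ (φ (B (e i))) (e i) : ℝ) = 0 := by
  have h1 := sum_bilin_skew e (A := φ)
    (LinearMap.mk₂ ℝ (fun u v ↦ (inner ℝ (B u) v : ℝ)) (by simp [inner_add_left])
      (by simp [real_inner_smul_left]) (by simp [inner_add_right])
      (by simp [real_inner_smul_right])) h.phi_skew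
  simp only [LinearMap.mk₂_apply] at h1
  have h2 : ∀ i, (inner ℝ (B (φ (e i))) (e i) : ℝ) = inner ℝ (B (e i)) (φ (e i)) := fun i ↦ by
    rw [h.B_symm, real_inner_comm]
  simp only [h2] at h1
  simp only [h.phi_skew, Finset.sum_neg_distrib]
  linarith

/-- The trace of `B = ∇ξ`, i.e. the divergence of `ξ`. -/
theorem ReebAlgebra.sum_inner_B (h : ReebAlgebra α ξ φ B) {n : ℕ}
    (hdim : Module.finrank ℝ V = 2 * n + 1) :
    ∑ i, (inner ℝ (B (e i)) (e i) : ℝ) = 2 * n * α := by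
  have hcard : (Fintype.card ι : ℝ) = 2 * n + 1 := by
    rw [← Module.finrank_eq_card_basis e.toBasis, hdim]
    push_cast
    ring
  have hxi : ∑ i, (inner ℝ ξ (e i) : ℝ) * inner ℝ ξ (e i) = 1 := by
    rw [← h.inner_xi, ← e.sum_inner_mul_inner ξ ξ]
    simp only [real_inner_comm]
  have hBxi : ∑ i, (inner ℝ ξ (e i) : ℝ) * inner ℝ ξ (B (e i)) = 0 :=
    Finset.sum_eq_zero fun i _ ↦ by rw [h.inner_B, mul_zero]
  have h1 := sum_bilin_skew e (A := φ)
    (LinearMap.mk₂ ℝ (fun u v ↦ (inner ℝ (φ (B u)) v : ℝ)) (by simp [inner_add_left])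
      (by simp [real_inner_smul_left]) (by simp [inner_add_right])
      (by simp [real_inner_smul_right])) h.phi_skew
  simp only [LinearMap.mk₂_apply] at h1
  have h2 : ∀ i, (inner ℝ (φ (B (φ (e i)))) (e i) : ℝ)
      = -(2 * α) * (1 - inner ℝ ξ (e i) * inner ℝ ξ (e i)) + inner ℝ (B (e i)) (e i) := fun i ↦ by
    have hi : (inner ℝ (e i) (e i) : ℝ) = 1 := by
      rw [real_inner_self_eq_norm_sq, e.norm_eq_one, one_pow]
    rw [h.B_phi, map_sub, map_smul, h.phi_phi, h.phi_phi, h.inner_B]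
    simp only [inner_sub_left, inner_add_left, inner_neg_left, real_inner_smul_left, hi]
    ring
  have h3 : ∀ i, (inner ℝ (φ (B (e i))) (φ (e i)) : ℝ) = inner ℝ (B (e i)) (e i) := fun i ↦ by
    rw [h.phi_skew, h.phi_phi, inner_add_right, inner_neg_right, real_inner_smul_right,
      real_inner_comm ξ, h.inner_B]
    ring
  simp only [h2, h3, Finset.sum_add_distrib, ← Finset.mul_sum, Finset.sum_sub_distrib, hxi,
    Finset.sum_const, Finset.card_univ, nsmul_eq_mul, hcard] at h1
  linarith

/-- The commutator of the Ricci operator with `φ`, on a single tangent space. Contracting the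
commutator `[R(X,Y), φ]` in two ways and using the first Bianchi identity expresses `φ(Qφ - φQ)`
through traces of that commutator, which is given by `hcomm`. -/
theorem ReebAlgebra.ricci_commutator (h : ReebAlgebra α ξ φ B) {n : ℕ}
    (hdim : Module.finrank ℝ V = 2 * n + 1) (R : V →ₗ[ℝ] V →ₗ[ℝ] V →ₗ[ℝ] V) {T : V →ₗ[ℝ] V}
    (hT : ∀ v, T v = κ • v + μ • (φ (B v) - α • φ v) + ν • φ (φ (B v) - α • φ v))
    (hswap : ∀ u v w, R u v w = -R v u w)
    (hbianchi : ∀ u v w, R u v w + R v w u + R w u v = 0)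
    (hskew : ∀ u v w z, (inner ℝ (R u v w) z : ℝ) = -inner ℝ w (R u v z))
    (hnull : ∀ u v, R u v ξ = (inner ℝ ξ v : ℝ) • T u - (inner ℝ ξ u : ℝ) • T v)
    (hcomm : ∀ u v w, R u v (φ w) - φ (R u v w)
      = (inner ℝ (φ (R u v ξ)) w : ℝ) • ξ - (inner ℝ ξ w : ℝ) • φ (R u v ξ)
        + (inner ℝ (φ (B v)) w : ℝ) • B u - (inner ℝ (φ (B u)) w : ℝ) • B v
        - (inner ℝ (B u) w : ℝ) • φ (B v) + (inner ℝ (B v) w : ℝ) • φ (B u)) (v : V) :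
    (∑ i, R (φ v) (e i) (e i)) - φ (∑ i, R v (e i) (e i))
      = (2 * μ) • (φ (B (φ v)) - α • φ (φ v))
        + (2 * (2 * α * ((n : ℝ) - 1) + ν)) • (φ (B v) - α • φ v) := by
  have hTξ : T ξ = κ • ξ := by
    rw [hT, h.B_xi, h.phi_xi]
    simp
  -- `A v = ∑ R(v, e_i) φ e_i`
  set A : V → V := fun v ↦ ∑ i, R v (e i) (φ (e i)) with hA
  -- the two contractions of `[R(X,Y), φ]`
  set C₁ : V → V := fun v ↦ ∑ i, (R v (e i) (φ (e i)) - φ (R v (e i) (e i))) with hC₁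
  set C₂ : V → V := fun v ↦ ∑ i, (R (e i) (φ (e i)) (φ v) - φ (R (e i) (φ (e i)) v)) with hC₂
  set Q : V → V := fun v ↦ ∑ i, R v (e i) (e i) with hQ
  have e1 : ∀ v, C₁ v = A v - φ (Q v) := fun v ↦ by
    simp only [hC₁, hA, hQ, Finset.sum_sub_distrib, map_sum]
  -- the first Bianchi identity, contracted with `φ`
  have e2 : ∀ v, (2 : ℝ) • A v = -∑ i, R (e i) (φ (e i)) v := fun v ↦ by
    have h1 := sum_bilin_skew e (R v) h.phi_skew
    have h2 : ∑ i, (R v (e i) (φ (e i)) + R (e i) (φ (e i)) v + R (φ (e i)) v (e i)) = 0 :=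
      Finset.sum_eq_zero fun i _ ↦ hbianchi _ _ _
    simp only [fun i ↦ hswap (φ (e i)) v (e i), Finset.sum_add_distrib, Finset.sum_neg_distrib, h1]
      at h2
    rw [eq_neg_iff_add_eq_zero, ← h2, two_smul]
    simp only [hA]
    abel
  have e3 : ∀ v, C₂ v = (2 : ℝ) • φ (A v) - (2 : ℝ) • A (φ v) := fun v ↦ by
    rw [← map_smul, e2, e2, map_neg, map_sum]
    simp only [hC₂, Finset.sum_sub_distrib]
    abel
  have e4 : (2 : ℝ) • φ (Q (φ v) - φ (Q v))
      = (2 : ℝ) • φ (C₁ v) - (2 : ℝ) • C₁ (φ v) - C₂ v := by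
    rw [e3, e1, e1, map_sub, map_sub]
    module
  -- multiples of `ξ` are not recorded, since `φ` will be applied to the result
  have c1 : ∀ v, ∃ a : ℝ, C₁ v = a • ξ - φ (T v) - B (φ (B v)) - φ (B (B v))
      + (2 * n * α) • φ (B v) := fun v ↦ by
    refine ⟨∑ i, (inner ℝ (φ (R v (e i) ξ)) (e i) : ℝ), ?_⟩
    have f1 : ∑ i, (inner ℝ ξ (e i) : ℝ) • φ (R v (e i) ξ) = φ (T v) := by
      have := sum_inner_smul_map e (φ ∘ₗ (R v).flip ξ) ξ
      simp only [LinearMap.comp_apply, LinearMap.flip_apply] at this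
      rw [this, hnull, h.inner_xi, hTξ, map_sub, map_smul, map_smul, map_smul, h.phi_xi]
      simp
    have f2 := sum_inner_smul_map e B (φ (B v))
    have f3 := sum_inner_smul_map e (φ ∘ₗ B) (B v)
    simp only [LinearMap.comp_apply] at f3
    simp only [hC₁, hcomm, Finset.sum_add_distrib, Finset.sum_sub_distrib, f1, f2, f3,
      ← Finset.sum_smul, h.sum_inner_phi_B e, h.sum_inner_B e hdim]
    module
  have c2 : ∀ v, ∃ a : ℝ, C₂ v = a • ξ := fun v ↦ by
    refine ⟨∑ i, (inner ℝ (φ (R (e i) (φ (e i)) ξ)) v : ℝ), ?_⟩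
    have f1 : ∑ i, (inner ℝ ξ v : ℝ) • φ (R (e i) (φ (e i)) ξ) = 0 := by
      have hi : ∀ i, R (e i) (φ (e i)) ξ = -((inner ℝ ξ (e i) : ℝ) • T (φ (e i))) := fun i ↦ by
        rw [hnull, h.inner_phi, zero_smul, zero_sub]
      have := sum_inner_smul_map e (T ∘ₗ φ) ξ
      simp only [LinearMap.comp_apply] at this
      rw [← Finset.smul_sum, ← map_sum]
      simp only [hi, Finset.sum_neg_distrib, this, h.phi_xi, map_zero, neg_zero, smul_zero]
    have f2 : ∑ i, (inner ℝ (φ (B (φ (e i)))) v : ℝ) • B (e i) = B (φ (B (φ v))) := by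
      rw [← sum_inner_smul_map e B (φ (B (φ v)))]
      refine Finset.sum_congr rfl fun i _ ↦ ?_
      rw [h.phi_skew, h.B_symm, h.phi_skew, neg_neg, real_inner_comm]
    have f3 : ∑ i, (inner ℝ (φ (B (e i))) v : ℝ) • B (φ (e i)) = -B (φ (B (φ v))) := by
      have := sum_inner_smul_map e (B ∘ₗ φ) (B (φ v))
      simp only [LinearMap.comp_apply] at this
      rw [← this, ← Finset.sum_neg_distrib]
      refine Finset.sum_congr rfl fun i _ ↦ ?_
      rw [h.phi_skew, h.B_symm, real_inner_comm, neg_smul]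
    have f4 : ∑ i, (inner ℝ (B (e i)) v : ℝ) • φ (B (φ (e i))) = φ (B (φ (B v))) := by
      have := sum_inner_smul_map e (φ ∘ₗ B ∘ₗ φ) (B v)
      simp only [LinearMap.comp_apply] at this
      rw [← this]
      refine Finset.sum_congr rfl fun i _ ↦ ?_
      rw [h.B_symm, real_inner_comm]
    have f5 : ∑ i, (inner ℝ (B (φ (e i))) v : ℝ) • φ (B (e i)) = -φ (B (φ (B v))) := by
      have := sum_inner_smul_map e (φ ∘ₗ B) (φ (B v))
      simp only [LinearMap.comp_apply] at this
      rw [← this, ← Finset.sum_neg_distrib]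
      refine Finset.sum_congr rfl fun i _ ↦ ?_
      rw [h.B_symm, h.phi_skew, real_inner_comm, neg_smul]
    have f6 : B (φ (B (φ v))) = φ (B (φ (B v))) := by
      simp only [h.B_phi, map_sub, map_smul, h.phi_phi, h.inner_B, h.B_xi, map_add, map_neg]
      simp
    simp only [hC₂, hcomm, Finset.sum_add_distrib, Finset.sum_sub_distrib, f1, f2, f3, f4, f5, f6,
      ← Finset.sum_smul]
    module
  -- `φ` determines a vector only up to a multiple of `ξ`; the missing component vanishes
  have hη : (inner ℝ ξ (Q (φ v) - φ (Q v)) : ℝ) = 0 := by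
    have : (inner ℝ ξ (Q (φ v)) : ℝ) = 0 := by
      simp only [hQ, inner_sum]
      have hi : ∀ i, (inner ℝ ξ (R (φ v) (e i) (e i)) : ℝ)
          = -(inner ℝ ξ (e i) * inner ℝ (e i) (T (φ v))) := fun i ↦ by
        have := hskew (φ v) (e i) ξ (e i)
        rw [hnull, h.inner_phi, zero_smul, sub_zero, real_inner_smul_left,
          real_inner_comm (e i) (T (φ v))] at this
        linarith
      simp only [hi, Finset.sum_neg_distrib, e.sum_inner_mul_inner, hT]
      simp only [inner_add_right, real_inner_smul_right, inner_sub_right, h.inner_phi]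
      ring
    rw [inner_sub_right, this, h.inner_phi, sub_zero]
  have hφφ := h.phi_phi (Q (φ v) - φ (Q v))
  rw [hη, zero_smul, add_zero] at hφφ
  obtain ⟨a₁, h₁⟩ := c1 v
  obtain ⟨a₂, h₂⟩ := c1 (φ v)
  obtain ⟨a₃, h₃⟩ := c2 v
  have key := congrArg φ e4
  rw [map_smul, hφφ, h₁, h₂, h₃] at key
  have hkey : Q (φ v) - φ (Q v) = (-1 / 2 : ℝ) • ((2 : ℝ) • -(Q (φ v) - φ (Q v))) := by module
  rw [hkey, key, hT, hT]
  simp only [map_add, map_sub, map_neg, map_smul, h.B_phi, h.phi_phi, h.phi_xi, h.B_xi,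
    h.inner_B, smul_zero, zero_smul, sub_zero, add_zero, zero_sub]
  module

end RicciAlgebra

/-! ### Covariant derivatives of fields of endomorphisms -/

section NablaEnd

variable {E : Type*} [NormedAddCommGroup E] [NormedSpace ℝ E] [FiniteDimensional ℝ E]
  {H : Type*} [TopologicalSpace H] {I : ModelWithCorners ℝ E H}
  {M : Type*} [TopologicalSpace M] [ChartedSpace H M] [IsManifold I ∞ M]

variable (I) in
/-- The field of endomorphisms `A` maps fields that are smooth near `p` to such fields. -/
def SmoothEndNear (A : Π x : M, TangentSpace I x →ₗ[ℝ] TangentSpace I x) (p : M) : Prop :=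
  ∀ X : Π x : M, TangentSpace I x, SmoothNear I X p → SmoothNear I (fun x ↦ A x (X x)) p

variable [RiemannianBundle (fun x : M ↦ TangentSpace I x)]
  [IsContMDiffRiemannianBundle I ∞ E (fun x : M ↦ TangentSpace I x)]
  {p : M} {X Y : Π x : M, TangentSpace I x}
  {A C : Π x : M, TangentSpace I x →ₗ[ℝ] TangentSpace I x}

namespace SmoothEndNear

theorem germTensorial_right (hA : SmoothEndNear I A p) (hX : SmoothNear I X p) :
    GermTensorial I
      (fun Y ↦ leviCivita I X (fun x ↦ A x (Y x)) p - A p (leviCivita I X Y p)) p where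
  smul {f Y} hf hY := by
    have h1 : (fun x ↦ A x ((f • Y) x)) = f • fun x ↦ A x (Y x) := by
      funext x
      simp
    rw [h1, leviCivita_smul_right hf hX (hA Y hY), leviCivita_smul_right hf hX hY, map_add,
      map_smul, map_smul]
    module
  add {Y Z} hY hZ := by
    have h1 : (fun x ↦ A x ((Y + Z) x)) = (fun x ↦ A x (Y x)) + fun x ↦ A x (Z x) := by
      funext x
      simp
    rw [h1, leviCivita_add_right hX (hA Y hY) (hA Z hZ), leviCivita_add_right hX hY hZ, map_add]
    module

theorem germTensorial_left (hA : SmoothEndNear I A p) (hY : SmoothNear I Y p) :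
    GermTensorial I
      (fun X ↦ leviCivita I X (fun x ↦ A x (Y x)) p - A p (leviCivita I X Y p)) p where
  smul {f X} hf hX := by
    rw [leviCivita_smul_left hf hX (hA Y hY), leviCivita_smul_left hf hX hY, map_smul]
    module
  add {X Z} hX hZ := by
    rw [leviCivita_add_left hX hZ (hA Y hY), leviCivita_add_left hX hZ hY, map_add]
    module

/-- The covariant derivative `(∇_u A) v` of a smooth field of endomorphisms. -/
def nabla (hA : SmoothEndNear I A p) :
    TangentSpace I p →ₗ[ℝ] TangentSpace I p →ₗ[ℝ] TangentSpace I p :=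
  LinearMap.mk₂ ℝ
    (fun u v ↦ leviCivita I (extendVector I u) (fun x ↦ A x (extendVector I v x)) p
      - A p (leviCivita I (extendVector I u) (extendVector I v) p))
    (fun u u' v ↦
      ((hA.germTensorial_left (smoothNear_extendVector v)).toLinearMap _).map_add u u')
    (fun c u v ↦
      ((hA.germTensorial_left (smoothNear_extendVector v)).toLinearMap _).map_smul c u)
    (fun u v v' ↦
      ((hA.germTensorial_right (smoothNear_extendVector u)).toLinearMap _).map_add v v')
    (fun c u v ↦
      ((hA.germTensorial_right (smoothNear_extendVector u)).toLinearMap _).map_smul c v)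

theorem nabla_apply (hA : SmoothEndNear I A p) (hX : SmoothNear I X p) (hY : SmoothNear I Y p) :
    hA.nabla (X p) (Y p)
      = leviCivita I X (fun x ↦ A x (Y x)) p - A p (leviCivita I X Y p) := by
  have hX' := smoothNear_extendVector (X p)
  have hY' := smoothNear_extendVector (Y p)
  rw [(hA.germTensorial_left hY).pointwise hX hX' (by simp),
    (hA.germTensorial_right hX').pointwise hY hY' (by simp)]
  rfl

theorem leviCivita_apply (hA : SmoothEndNear I A p) (hX : SmoothNear I X p)
    (hY : SmoothNear I Y p) :
    leviCivita I X (fun x ↦ A x (Y x)) p = hA.nabla (X p) (Y p) + A p (leviCivita I X Y p) := by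
  rw [hA.nabla_apply hX hY, sub_add_cancel]

/-- The covariant derivative of a symmetric (`ε = 1`) or skew-symmetric (`ε = -1`) field of
endomorphisms is again symmetric or skew-symmetric. -/
theorem inner_nabla (hA : SmoothEndNear I A p) {ε : ℝ}
    (h : ∀ x u v, (inner ℝ (A x u) v : ℝ) = ε * inner ℝ u (A x v)) (u v w : TangentSpace I p) :
    (inner ℝ (hA.nabla u v) w : ℝ) = ε * inner ℝ v (hA.nabla u w) := by
  have hX := smoothNear_extendVector u
  have hY := smoothNear_extendVector v
  have hZ := smoothNear_extendVector w
  have hXp := extendVector_self (I := I) u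
  have hYp := extendVector_self (I := I) v
  have hZp := extendVector_self (I := I) w
  set X := extendVector I u
  set Y := extendVector I v
  set Z := extendVector I w
  have h1 := mvfderiv_inner hX (hA Y hY) hZ
  have h2 := mvfderiv_inner hX hY (hA Z hZ)
  have h3 : mvfderiv I (fun x ↦ (inner ℝ (A x (Y x)) (Z x) : ℝ)) p (X p)
      = ε * mvfderiv I (fun x ↦ (inner ℝ (Y x) (A x (Z x)) : ℝ)) p (X p) := by
    simp only [h]
    rw [mvfderiv_fun_mul (smoothFunNear_const ε).mdifferentiableAt
      (hY.inner_field (hA Z hZ)).mdifferentiableAt, mvfderiv_const]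
    simp
  rw [h3, h2, hA.leviCivita_apply hX hY, hA.leviCivita_apply hX hZ, hXp, hYp, hZp] at h1
  simp only [inner_add_left, inner_add_right, h] at h1
  linarith

end SmoothEndNear

/-- The endomorphism `v ↦ ∇_v ξ` of the tangent space at `x`, for a smooth vector field `ξ`. -/
def nablaField {ξ : Π x : M, TangentSpace I x} (hξ : ∀ x, SmoothNear I ξ x) (x : M) :
    TangentSpace I x →ₗ[ℝ] TangentSpace I x :=
  (germTensorial_leviCivita_left (hξ x)).toLinearMap _

variable {ξ : Π x : M, TangentSpace I x}

theorem nablaField_apply (hξ : ∀ x, SmoothNear I ξ x) (hX : SmoothNear I X p) :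
    nablaField hξ p (X p) = leviCivita I X ξ p :=
  (germTensorial_leviCivita_left (hξ p)).toLinearMap_apply hX

theorem nablaField_eventually (hξ : ∀ x, SmoothNear I ξ x) (hX : SmoothNear I X p) :
    ∀ᶠ x in 𝓝 p, nablaField hξ x (X x) = leviCivita I X ξ x :=
  hX.eventually.mono fun _ hx ↦ nablaField_apply hξ hx

theorem smoothEndNear_nablaField (hξ : ∀ x, SmoothNear I ξ x) (p : M) :
    SmoothEndNear I (nablaField hξ) p := fun _ hX ↦
  (smoothNear_leviCivita hX (hξ p)).congr (nablaField_eventually hξ hX)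

/-- The curvature on `ξ` is the antisymmetrised second covariant derivative of `ξ`. -/
theorem curvature_apply_field (hξ : ∀ x, SmoothNear I ξ x) (u v : TangentSpace I p) :
    curvature I p u v (ξ p) = (smoothEndNear_nablaField hξ p).nabla u v
      - (smoothEndNear_nablaField hξ p).nabla v u := by
  have hX := smoothNear_extendVector u
  have hY := smoothNear_extendVector v
  have hXp := extendVector_self (I := I) u
  have hYp := extendVector_self (I := I) v
  have hD := smoothEndNear_nablaField hξ p
  set X := extendVector I u
  set Y := extendVector I v
  have h1 := curvatureField_eq_curvature hX hY (hξ p)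
  have h2 := hD.nabla_apply hX hY
  have h3 := hD.nabla_apply hY hX
  have h4 := nablaField_apply hξ (smoothNear_mlieBracket hX hY)
  rw [leviCivita_congr_right (nablaField_eventually hξ hY)] at h2
  rw [leviCivita_congr_right (nablaField_eventually hξ hX)] at h3
  rw [← leviCivita_sub_leviCivita hX hY, map_sub] at h4
  rw [hXp, hYp] at h1 h2 h3
  rw [← h1, h2, h3, curvatureField, ← h4]
  abel

end NablaEnd

/-! ### Almost contact metric and almost `α`-cosymplectic structures -/

section AlmostContactGeometry

variable {E : Type*} [NormedAddCommGroup E] [NormedSpace ℝ E] [FiniteDimensional ℝ E]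
  {H : Type*} [TopologicalSpace H] {I : ModelWithCorners ℝ E H}
  {M : Type*} [TopologicalSpace M] [ChartedSpace H M] [IsManifold I ∞ M]
  [RiemannianBundle (fun x : M ↦ TangentSpace I x)]
  {φ : Π x : M, TangentSpace I x →L[ℝ] TangentSpace I x} {ξ : Π x : M, TangentSpace I x}
  {η : Π x : M, TangentSpace I x →L[ℝ] ℝ} {α : ℝ} {p : M}

namespace IsAlmostContactMetric

variable (h : IsAlmostContactMetric I φ ξ η)
include h

theorem smoothNear_xi (p : M) : SmoothNear I ξ p :=
  Filter.Eventually.of_forall fun x ↦ h.smooth_xi x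

theorem smoothEndNear_phi (p : M) : SmoothEndNear I (fun x ↦ (φ x).toLinearMap) p := by
  intro X hX
  filter_upwards [hX] with x hx
  exact ContMDiffAt.clm_bundle_apply (F₁ := E) (F₂ := E) (E₁ := fun x : M ↦ TangentSpace I x)
    (E₂ := fun x : M ↦ TangentSpace I x) (h.smooth_phi x) hx

theorem phi_xi (p : M) : φ p (ξ p) = 0 := by
  have h1 : φ p (φ p (ξ p)) = 0 := by rw [h.phi_phi, h.eta_xi, one_smul, neg_add_cancel]
  have h2 : φ p (ξ p) = η p (φ p (ξ p)) • ξ p := by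
    have := h.phi_phi p (φ p (ξ p))
    rw [h1, map_zero] at this
    rw [eq_comm, neg_add_eq_zero] at this
    exact this
  have h3 : (η p (φ p (ξ p)) * η p (φ p (ξ p))) • ξ p = 0 := by
    rw [h2, map_smul, h2, smul_smul] at h1
    simpa [h.eta_xi] using h1
  have h4 : η p (φ p (ξ p)) = 0 := by
    have := congrArg (η p) h3
    rw [map_smul, h.eta_xi, map_zero, smul_eq_mul, mul_one] at this
    exact mul_self_eq_zero.1 this
  rw [h2, h4, zero_smul]

theorem eta_eq (p : M) (v : TangentSpace I p) : η p v = inner ℝ (ξ p) v := by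
  have := h.compatible p (ξ p) v
  rw [h.phi_xi, inner_zero_left, h.eta_xi, one_mul] at this
  linarith

theorem phi_phi' (p : M) (v : TangentSpace I p) :
    φ p (φ p v) = -v + (inner ℝ (ξ p) v : ℝ) • ξ p := by
  rw [h.phi_phi, h.eta_eq]

theorem inner_xi (p : M) : (inner ℝ (ξ p) (ξ p) : ℝ) = 1 := by
  rw [← h.eta_eq, h.eta_xi]

theorem eta_phi (p : M) (v : TangentSpace I p) : η p (φ p v) = 0 := by
  have e1 := h.phi_phi p (φ p v)
  have e2 : φ p (φ p (φ p v)) = -φ p v := by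
    rw [h.phi_phi p v, map_add, map_neg, map_smul, h.phi_xi, smul_zero, add_zero]
  rw [e2, left_eq_add] at e1
  have e3 := congrArg (η p) e1
  rwa [map_zero, map_smul, h.eta_xi, smul_eq_mul, mul_one] at e3

theorem phi_skew (p : M) (u v : TangentSpace I p) :
    (inner ℝ (φ p u) v : ℝ) = -inner ℝ u (φ p v) := by
  have h1 : (inner ℝ (φ p u) (ξ p) : ℝ) = 0 := by
    rw [real_inner_comm, ← h.eta_eq, h.eta_phi]
  have h2 := h.compatible p u (φ p v)
  rw [h.phi_phi, inner_add_right, inner_neg_right, real_inner_smul_right, h1, h.eta_phi] at h2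
  linarith

end IsAlmostContactMetric

variable [IsContMDiffRiemannianBundle I ∞ E (fun x : M ↦ TangentSpace I x)]

namespace IsAlmostContactMetric

/-- The endomorphism `B = ∇ξ`. -/
abbrev nablaXi (h : IsAlmostContactMetric I φ ξ η) (p : M) :
    TangentSpace I p →ₗ[ℝ] TangentSpace I p :=
  nablaField h.smoothNear_xi p

/-- The covariant derivative `(∇_u φ) v`. -/
abbrev nablaPhi (h : IsAlmostContactMetric I φ ξ η) (p : M) :
    TangentSpace I p →ₗ[ℝ] TangentSpace I p →ₗ[ℝ] TangentSpace I p :=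
  (h.smoothEndNear_phi p).nabla

/-- The covariant derivative `(∇_u B) v` of `B = ∇ξ`. -/
abbrev nablaNablaXi (h : IsAlmostContactMetric I φ ξ η) (p : M) :
    TangentSpace I p →ₗ[ℝ] TangentSpace I p →ₗ[ℝ] TangentSpace I p :=
  (smoothEndNear_nablaField h.smoothNear_xi p).nabla

theorem inner_nablaPhi (h : IsAlmostContactMetric I φ ξ η) (u v w : TangentSpace I p) :
    (inner ℝ (h.nablaPhi p u v) w : ℝ) = -inner ℝ v (h.nablaPhi p u w) := by
  have := (h.smoothEndNear_phi p).inner_nabla (ε := -1)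
    (fun x u v ↦ by rw [neg_one_mul]; exact h.phi_skew x u v) u v w
  rwa [neg_one_mul] at this

/-- The derivative of the function `⟪ξ, Y⟫` is `⟪B X, Y⟫ + ⟪ξ, ∇_X Y⟫`. -/
theorem mvfderiv_inner_xi (h : IsAlmostContactMetric I φ ξ η) {X Y : Π x : M, TangentSpace I x}
    (hX : SmoothNear I X p) (hY : SmoothNear I Y p) :
    mvfderiv I (fun x ↦ (inner ℝ (ξ x) (Y x) : ℝ)) p (X p)
      = inner ℝ (h.nablaXi p (X p)) (Y p) + inner ℝ (ξ p) (leviCivita I X Y p) := by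
  rw [mvfderiv_inner hX (h.smoothNear_xi p) hY, nablaField_apply h.smoothNear_xi hX]

theorem inner_xi_nablaXi (h : IsAlmostContactMetric I φ ξ η) (v : TangentSpace I p) :
    (inner ℝ (ξ p) (h.nablaXi p v) : ℝ) = 0 := by
  have hX := smoothNear_extendVector v
  have h1 := h.mvfderiv_inner_xi hX (h.smoothNear_xi p)
  simp only [h.inner_xi, mvfderiv_const, ← nablaField_apply h.smoothNear_xi hX, extendVector_self]
    at h1
  rw [real_inner_comm] at h1
  have h2 : (0 : ℝ) = 2 * inner ℝ (ξ p) (h.nablaXi p v) := by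
    rw [two_mul]
    simpa using h1
  linarith

/-- The derivative of `φ² = -1 + η ⊗ ξ`. -/
theorem nablaPhi_phi (h : IsAlmostContactMetric I φ ξ η) (u v : TangentSpace I p) :
    h.nablaPhi p u (φ p v) + φ p (h.nablaPhi p u v)
      = (inner ℝ (h.nablaXi p u) v : ℝ) • ξ p + (inner ℝ (ξ p) v : ℝ) • h.nablaXi p u := by
  have hX := smoothNear_extendVector u
  have hY := smoothNear_extendVector v
  have hXp := extendVector_self (I := I) u
  have hYp := extendVector_self (I := I) v
  set X := extendVector I u
  set Y := extendVector I v
  have hφ := h.smoothEndNear_phi p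
  have hξ := h.smoothNear_xi p
  have hφY : SmoothNear I (fun x ↦ φ x (Y x)) p := hφ Y hY
  have h1 : leviCivita I X (fun x ↦ φ x (φ x (Y x))) p
      = h.nablaPhi p u (φ p v) + φ p (h.nablaPhi p u v + φ p (leviCivita I X Y p)) := by
    have e1 := hφ.leviCivita_apply hX hφY
    have e2 := hφ.leviCivita_apply hX hY
    rw [hXp, hYp] at e1 e2
    refine e1.trans ?_
    congr 1
    exact congrArg (φ p) e2
  have hf := hξ.inner_field hY
  have h2 : (fun x ↦ φ x (φ x (Y x))) = -Y + (fun x ↦ (inner ℝ (ξ x) (Y x) : ℝ)) • ξ := by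
    funext x
    exact h.phi_phi' x (Y x)
  rw [h2, leviCivita_add_right hX hY.neg (hξ.smul hf), leviCivita_neg_right hX hY,
    leviCivita_smul_right hf hX hξ, h.mvfderiv_inner_xi hX hY,
    ← nablaField_apply h.smoothNear_xi hX, map_add, h.phi_phi', hXp, hYp] at h1
  have h3 : h.nablaPhi p u (φ p v) + φ p (h.nablaPhi p u v)
      = (h.nablaPhi p u (φ p v) + (φ p (h.nablaPhi p u v) + (-leviCivita I X Y p
        + (inner ℝ (ξ p) (leviCivita I X Y p) : ℝ) • ξ p))) + leviCivita I X Y p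
        - (inner ℝ (ξ p) (leviCivita I X Y p) : ℝ) • ξ p := by
    abel
  rw [h3, ← h1]
  module

theorem nablaPhi_xi (h : IsAlmostContactMetric I φ ξ η) (u : TangentSpace I p) :
    h.nablaPhi p u (ξ p) = -φ p (h.nablaXi p u) := by
  have hX := smoothNear_extendVector u
  have h1 := (h.smoothEndNear_phi p).nabla_apply hX (h.smoothNear_xi p)
  have h2 : (fun x ↦ (φ x).toLinearMap (ξ x)) = 0 := funext fun x ↦ h.phi_xi x
  have h3 : leviCivita I (extendVector I u) 0 p = 0 := by
    have := leviCivita_const_smul_right 0 hX (h.smoothNear_xi p)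
    rwa [zero_smul, zero_smul] at this
  rw [h2, h3, ← nablaField_apply h.smoothNear_xi hX, extendVector_self, zero_sub] at h1
  exact h1

end IsAlmostContactMetric

namespace IsAlmostAlphaCosymplectic

variable (h : IsAlmostAlphaCosymplectic I α φ ξ η)
include h

theorem nablaXi_symm (u v : TangentSpace I p) :
    (inner ℝ (h.nablaXi p u) v : ℝ) = inner ℝ u (h.nablaXi p v) := by
  have hX := smoothNear_extendVector u
  have hY := smoothNear_extendVector v
  have hXp := extendVector_self (I := I) u
  have hYp := extendVector_self (I := I) v
  set X := extendVector I u
  set Y := extendVector I v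
  have h1 := h.d_eta p X Y hX.smoothFieldAt hY.smoothFieldAt
  unfold extDerivOne at h1
  simp only [h.eta_eq] at h1
  rw [h.mvfderiv_inner_xi hX hY, h.mvfderiv_inner_xi hY hX, ← leviCivita_sub_leviCivita hX hY,
    inner_sub_right, hXp, hYp] at h1
  rw [real_inner_comm (h.nablaXi p v) u]
  linarith

theorem nablaXi_xi (p : M) : h.nablaXi p (ξ p) = 0 := by
  refine ext_inner_right ℝ fun v ↦ ?_
  rw [h.nablaXi_symm, h.inner_xi_nablaXi, inner_zero_left]

/-- `dΦ = 2α η ∧ Φ` in terms of `∇φ`. -/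
theorem cyclic_nablaPhi (u v w : TangentSpace I p) :
    (inner ℝ (h.nablaPhi p u v) w + inner ℝ (h.nablaPhi p v w) u
      + inner ℝ (h.nablaPhi p w u) v : ℝ)
      = 2 * α * (inner ℝ (ξ p) u * inner ℝ (φ p v) w + inner ℝ (ξ p) v * inner ℝ (φ p w) u
        + inner ℝ (ξ p) w * inner ℝ (φ p u) v) := by
  have hX := smoothNear_extendVector u
  have hY := smoothNear_extendVector v
  have hZ := smoothNear_extendVector w
  have hXp := extendVector_self (I := I) u
  have hYp := extendVector_self (I := I) v
  have hZp := extendVector_self (I := I) w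
  set X := extendVector I u
  set Y := extendVector I v
  set Z := extendVector I w
  have h1 := h.d_fundamentalForm p X Y Z hX.smoothFieldAt hY.smoothFieldAt hZ.smoothFieldAt
  have key : ∀ A B C : Π x : M, TangentSpace I x, SmoothNear I A p → SmoothNear I B p →
      SmoothNear I C p → mvfderiv I (fun x ↦ (inner ℝ (φ x (B x)) (C x) : ℝ)) p (A p)
        = inner ℝ (h.nablaPhi p (A p) (B p)) (C p) + inner ℝ (φ p (leviCivita I A B p)) (C p)
          - inner ℝ (φ p (leviCivita I A C p)) (B p) := by
    intro A B C hA hB hC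
    have hφ := h.smoothEndNear_phi p
    have e1 := mvfderiv_inner hA (hφ B hB) hC
    rw [hφ.leviCivita_apply hA hB, inner_add_left] at e1
    refine e1.trans ?_
    have e2 : (inner ℝ (φ p (B p)) (leviCivita I A C p) : ℝ)
        = -inner ℝ (φ p (leviCivita I A C p)) (B p) := by
      rw [h.phi_skew, real_inner_comm]
    rw [sub_eq_add_neg, ← e2]
    rfl
  unfold extDerivTwo fundamentalForm wedgeOneTwo at h1
  rw [key X Y Z hX hY hZ, key Y Z X hY hZ hX, key Z X Y hZ hX hY,
    ← leviCivita_sub_leviCivita hX hY, ← leviCivita_sub_leviCivita hY hZ,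
    ← leviCivita_sub_leviCivita hZ hX, hXp, hYp, hZp] at h1
  simp only [map_sub, inner_sub_left, h.eta_eq] at h1
  linarith

/-- `∇_ξ φ = 0`. -/
theorem nablaPhi_xi_left (v : TangentSpace I p) : h.nablaPhi p (ξ p) v = 0 :=
  (nablaXiPhi_eq_zero_and_anticommute (φ := (φ p).toLinearMap) (F := fun u v ↦ h.nablaPhi p u v)
    (h.inner_xi p) (h.phi_phi' p) (h.phi_xi p) (h.phi_skew p) h.nablaXi_symm (h.nablaXi_xi p)
    h.inner_nablaPhi h.nablaPhi_xi h.nablaPhi_phi h.cyclic_nablaPhi).1 v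

theorem reebAlgebra (p : M) : ReebAlgebra α (ξ p) (φ p).toLinearMap (h.nablaXi p) where
  inner_xi := h.inner_xi p
  phi_phi := h.phi_phi' p
  phi_xi := h.phi_xi p
  phi_skew := h.phi_skew p
  B_symm := h.nablaXi_symm
  B_xi := h.nablaXi_xi p
  B_phi := (nablaXiPhi_eq_zero_and_anticommute (φ := (φ p).toLinearMap)
    (F := fun u v ↦ h.nablaPhi p u v) (h.inner_xi p) (h.phi_phi' p) (h.phi_xi p) (h.phi_skew p)
    h.nablaXi_symm (h.nablaXi_xi p) h.inner_nablaPhi h.nablaPhi_xi h.nablaPhi_phi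
    h.cyclic_nablaPhi).2

/-- `h = φB - αφ`, equivalently `∇_v ξ = -αφ²v - φhv`. -/
theorem hTensor_eq (v : TangentSpace I p) :
    hTensor I φ ξ p v = φ p (h.nablaXi p v) - α • φ p v := by
  have hY := smoothNear_extendVector v
  have hYp := extendVector_self (I := I) v
  unfold hTensor
  set Y := extendVector I v
  have hφ := h.smoothEndNear_phi p
  have hξ := h.smoothNear_xi p
  have hφY : SmoothNear I (fun x ↦ φ x (Y x)) p := hφ Y hY
  have e1 := hφ.leviCivita_apply hξ hY
  have e2 := h.nablaPhi_xi_left (Y p)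
  have e3 : leviCivita I ξ (fun x ↦ φ x (Y x)) p = φ p (leviCivita I ξ Y p) := by
    refine e1.trans ?_
    rw [show hφ.nabla (ξ p) (Y p) = 0 from e2, zero_add]
    rfl
  have e4 : h.nablaXi p (φ p (Y p)) = (2 * α) • φ p (Y p) - φ p (h.nablaXi p (Y p)) :=
    (h.reebAlgebra p).B_phi (Y p)
  rw [← leviCivita_sub_leviCivita hξ hφY, ← leviCivita_sub_leviCivita hξ hY, e3,
    ← nablaField_apply h.smoothNear_xi hφY, ← nablaField_apply h.smoothNear_xi hY, map_sub]
  rw [show nablaField h.smoothNear_xi p (φ p (Y p)) = _ from e4, hYp]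
  module

/-- The derivative of `φB + Bφ = 2αφ`. -/
theorem nabla_anticommute (u v : TangentSpace I p) :
    h.nablaPhi p u (h.nablaXi p v) + φ p (h.nablaNablaXi p u v)
      + (h.nablaNablaXi p u (φ p v) + h.nablaXi p (h.nablaPhi p u v))
      = (2 * α) • h.nablaPhi p u v := by
  have hX := smoothNear_extendVector u
  have hY := smoothNear_extendVector v
  have hXp := extendVector_self (I := I) u
  have hYp := extendVector_self (I := I) v
  set X := extendVector I u
  set Y := extendVector I v
  have hφ := h.smoothEndNear_phi p
  have hB := smoothEndNear_nablaField h.smoothNear_xi p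
  have hφY := hφ Y hY
  have hBY := hB Y hY
  have hφBY := hφ _ hBY
  have hBφY := hB _ hφY
  have h1 : (fun x ↦ nablaField h.smoothNear_xi x ((φ x).toLinearMap (Y x)))
      = ((2 * α) • fun x ↦ (φ x).toLinearMap (Y x))
        - fun x ↦ (φ x).toLinearMap (nablaField h.smoothNear_xi x (Y x)) :=
    funext fun x ↦ (h.reebAlgebra x).B_phi (Y x)
  have h2 := hB.leviCivita_apply hX hφY
  rw [h1, leviCivita_sub_right hX (hφY.const_smul (2 * α)) hφBY,
    leviCivita_const_smul_right _ hX hφY, hφ.leviCivita_apply hX hBY,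
    hB.leviCivita_apply hX hY, hφ.leviCivita_apply hX hY, map_add, map_add, hXp, hYp] at h2
  have h3 := (h.reebAlgebra p).B_phi (leviCivita I X Y p)
  change nablaField h.smoothNear_xi p ((φ p).toLinearMap (leviCivita I X Y p)) = _ at h3
  rw [h3] at h2
  change hφ.nabla u (nablaField h.smoothNear_xi p v) + (φ p).toLinearMap (hB.nabla u v)
    + (hB.nabla u ((φ p).toLinearMap v) + nablaField h.smoothNear_xi p (hφ.nabla u v))
    = (2 * α) • hφ.nabla u v
  rw [← sub_eq_zero] at h2 ⊢
  rw [← neg_eq_zero, ← h2]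
  module

theorem nablaNablaXi_symm (u v w : TangentSpace I p) :
    (inner ℝ (h.nablaNablaXi p u v) w : ℝ) = inner ℝ v (h.nablaNablaXi p u w) := by
  have := (smoothEndNear_nablaField h.smoothNear_xi p).inner_nabla (ε := 1)
    (fun x u v ↦ by rw [one_mul]; exact h.nablaXi_symm u v) u v w
  rwa [one_mul] at this

theorem nablaNablaXi_xi (u : TangentSpace I p) :
    h.nablaNablaXi p u (ξ p) = -h.nablaXi p (h.nablaXi p u) := by
  have hX := smoothNear_extendVector u
  have h1 := (smoothEndNear_nablaField h.smoothNear_xi p).nabla_apply hX (h.smoothNear_xi p)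
  have h2 : (fun x ↦ nablaField h.smoothNear_xi x (ξ x)) = 0 := funext fun x ↦ h.nablaXi_xi x
  have h3 : leviCivita I (extendVector I u) 0 p = 0 := by
    have := leviCivita_const_smul_right 0 hX (h.smoothNear_xi p)
    rwa [zero_smul, zero_smul] at this
  rw [h2, h3, ← nablaField_apply h.smoothNear_xi hX, extendVector_self, zero_sub] at h1
  exact h1

end IsAlmostAlphaCosymplectic

end AlmostContactGeometry

/-! ### `(κ,μ,ν)`-spaces -/

section KappaMuNu

variable {E : Type*} [NormedAddCommGroup E] [NormedSpace ℝ E] [FiniteDimensional ℝ E]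
  {H : Type*} [TopologicalSpace H] {I : ModelWithCorners ℝ E H}
  {M : Type*} [TopologicalSpace M] [ChartedSpace H M] [IsManifold I ∞ M]
  [RiemannianBundle (fun x : M ↦ TangentSpace I x)]
  [IsContMDiffRiemannianBundle I ∞ E (fun x : M ↦ TangentSpace I x)]
  {φ : Π x : M, TangentSpace I x →L[ℝ] TangentSpace I x} {ξ : Π x : M, TangentSpace I x}
  {η : Π x : M, TangentSpace I x →L[ℝ] ℝ} {α : ℝ} {κ μ ν : M → ℝ} {p : M}
  {X Y Z : Π x : M, TangentSpace I x}

namespace IsAlmostContactMetric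

/-- The formula `(∇_u φ) v = g(φBu, v) ξ - η(v) φBu`, with `B = ∇ξ`. It says that the leaves of
`ker η` are Kähler manifolds. -/
def HasKaehlerLeavesAt (h : IsAlmostContactMetric I φ ξ η) (p : M) : Prop :=
  ∀ u v : TangentSpace I p, h.nablaPhi p u v = (inner ℝ (φ p (h.nablaXi p u)) v : ℝ) • ξ p
    - (inner ℝ (ξ p) v : ℝ) • φ p (h.nablaXi p u)

theorem HasKaehlerLeavesAt.leviCivita_phi {h : IsAlmostContactMetric I φ ξ η}
    (hK : h.HasKaehlerLeavesAt p) (hX : SmoothNear I X p) (hY : SmoothNear I Y p) :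
    leviCivita I X (fun x ↦ φ x (Y x)) p = φ p (leviCivita I X Y p)
      + ((inner ℝ (φ p (leviCivita I X ξ p)) (Y p) : ℝ) • ξ p
        - (inner ℝ (ξ p) (Y p) : ℝ) • φ p (leviCivita I X ξ p)) := by
  rw [← nablaField_apply h.smoothNear_xi hX, ← hK (X p) (Y p)]
  exact ((h.smoothEndNear_phi p).leviCivita_apply hX hY).trans (add_comm _ _)

/-- `∇_X ∇_Y (φZ)` on a manifold with Kähler leaves. -/
theorem leviCivita_leviCivita_phi {h : IsAlmostContactMetric I φ ξ η}
    (hK : ∀ᶠ x in 𝓝 p, h.HasKaehlerLeavesAt x) (hX : SmoothNear I X p) (hY : SmoothNear I Y p)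
    (hZ : SmoothNear I Z p) :
    leviCivita I X (leviCivita I Y (fun x ↦ φ x (Z x))) p
      = φ p (leviCivita I X (leviCivita I Y Z) p)
        + ((inner ℝ (φ p (leviCivita I X ξ p)) (leviCivita I Y Z p) : ℝ) • ξ p
          - (inner ℝ (ξ p) (leviCivita I Y Z p) : ℝ) • φ p (leviCivita I X ξ p))
        + ((inner ℝ (φ p (leviCivita I X (leviCivita I Y ξ) p)) (Z p)
            + inner ℝ (φ p (leviCivita I Y ξ p)) (leviCivita I X Z p) : ℝ) • ξ p
          + (inner ℝ (φ p (leviCivita I Y ξ p)) (Z p) : ℝ) • leviCivita I X ξ p)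
        - ((inner ℝ (leviCivita I X ξ p) (Z p) + inner ℝ (ξ p) (leviCivita I X Z p) : ℝ)
            • φ p (leviCivita I Y ξ p)
          + (inner ℝ (ξ p) (Z p) : ℝ) • φ p (leviCivita I X (leviCivita I Y ξ) p)) := by
  have hξ := h.smoothNear_xi p
  have hYZ := smoothNear_leviCivita hY hZ
  have hYξ := smoothNear_leviCivita hY hξ
  have hP := h.smoothEndNear_phi p _ hYξ
  have hφYZ := h.smoothEndNear_phi p _ hYZ
  set P : Π x : M, TangentSpace I x := fun x ↦ φ x (leviCivita I Y ξ x) with hPdef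
  change SmoothNear I P p at hP
  change SmoothNear I (fun x ↦ φ x (leviCivita I Y Z x)) p at hφYZ
  have h1 : ∀ᶠ x in 𝓝 p, leviCivita I Y (fun x ↦ φ x (Z x)) x
      = ((fun x ↦ φ x (leviCivita I Y Z x)) + ((fun x ↦ (inner ℝ (P x) (Z x) : ℝ)) • ξ
        - (fun x ↦ (inner ℝ (ξ x) (Z x) : ℝ)) • P)) x := by
    filter_upwards [hK, hY.eventually, hZ.eventually] with x hKx hYx hZx
    exact hKx.leviCivita_phi hYx hZx
  have hf := hP.inner_field hZ
  have hg := hξ.inner_field hZ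
  have hKp := hK.self_of_nhds
  have h2 : (inner ℝ (ξ p) (leviCivita I Y ξ p) : ℝ) = 0 := by
    rw [← nablaField_apply h.smoothNear_xi hY]
    exact h.inner_xi_nablaXi (Y p)
  have h3 : leviCivita I X P p = φ p (leviCivita I X (leviCivita I Y ξ) p)
      + (inner ℝ (φ p (leviCivita I X ξ p)) (leviCivita I Y ξ p) : ℝ) • ξ p := by
    rw [hPdef, hKp.leviCivita_phi hX hYξ, h2, zero_smul, sub_zero]
  rw [leviCivita_congr_right h1, leviCivita_add_right hX hφYZ ((hξ.smul hf).sub (hP.smul hg)),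
    leviCivita_sub_right hX (hξ.smul hf) (hP.smul hg), leviCivita_smul_right hf hX hξ,
    leviCivita_smul_right hg hX hP, mvfderiv_inner hX hP hZ, mvfderiv_inner hX hξ hZ,
    hKp.leviCivita_phi hX hYZ, h3, inner_add_left, real_inner_smul_left]
  module

/-- The Ricci identity for `φ` on a manifold with Kähler leaves. -/
theorem curvature_phi {h : IsAlmostContactMetric I φ ξ η}
    (hK : ∀ᶠ x in 𝓝 p, h.HasKaehlerLeavesAt x) (u v w : TangentSpace I p) :
    curvature I p u v (φ p w) - φ p (curvature I p u v w)
      = (inner ℝ (φ p (curvature I p u v (ξ p))) w : ℝ) • ξ p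
        - (inner ℝ (ξ p) w : ℝ) • φ p (curvature I p u v (ξ p))
        + (inner ℝ (φ p (h.nablaXi p v)) w : ℝ) • h.nablaXi p u
        - (inner ℝ (φ p (h.nablaXi p u)) w : ℝ) • h.nablaXi p v
        - (inner ℝ (h.nablaXi p u) w : ℝ) • φ p (h.nablaXi p v)
        + (inner ℝ (h.nablaXi p v) w : ℝ) • φ p (h.nablaXi p u) := by
  have hX := smoothNear_extendVector u
  have hY := smoothNear_extendVector v
  have hZ := smoothNear_extendVector w
  have hXp := extendVector_self (I := I) u
  have hYp := extendVector_self (I := I) v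
  have hZp := extendVector_self (I := I) w
  set X := extendVector I u
  set Y := extendVector I v
  set Z := extendVector I w
  have hφZ : SmoothNear I (fun x ↦ φ x (Z x)) p := h.smoothEndNear_phi p _ hZ
  have hBX : h.nablaXi p u = leviCivita I X ξ p := by
    rw [← hXp]
    exact nablaField_apply h.smoothNear_xi hX
  have hBY : h.nablaXi p v = leviCivita I Y ξ p := by
    rw [← hYp]
    exact nablaField_apply h.smoothNear_xi hY
  have h1 := curvatureField_eq_curvature hX hY hφZ
  have h2 := curvatureField_eq_curvature hX hY hZ
  have h3 := curvatureField_eq_curvature hX hY (h.smoothNear_xi p)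
  rw [hXp, hYp, hZp] at h1 h2
  rw [hXp, hYp] at h3
  rw [hBX, hBY, ← h1, ← h2, ← h3]
  unfold curvatureField
  rw [leviCivita_leviCivita_phi hK hX hY hZ, leviCivita_leviCivita_phi hK hY hX hZ,
    hK.self_of_nhds.leviCivita_phi (smoothNear_mlieBracket hX hY) hZ, hZp]
  simp only [map_sub, inner_sub_left]
  module

end IsAlmostContactMetric

namespace IsKappaMuNuSpace

variable (hM : IsKappaMuNuSpace I α φ ξ η κ μ ν)
include hM

/-- The operator `κ + μh + νφh`, written with `h = φB - αφ`. -/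
theorem nullityOperator_eq (v : TangentSpace I p) :
    nullityOperator I φ ξ κ μ ν p v = κ p • v + μ p • (φ p (hM.nablaXi p v) - α • φ p v)
      + ν p • φ p (φ p (hM.nablaXi p v) - α • φ p v) := by
  rw [nullityOperator, hM.hTensor_eq]

theorem curvature_xi (u v : TangentSpace I p) :
    curvature I p u v (ξ p) = (inner ℝ (ξ p) v : ℝ) • nullityOperator I φ ξ κ μ ν p u
      - (inner ℝ (ξ p) u : ℝ) • nullityOperator I φ ξ κ μ ν p v := by
  rw [hM.nullity, hM.eta_eq, hM.eta_eq]

/-- The nullity condition as a Codazzi type equation for `B = ∇ξ`. -/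
theorem nablaNablaXi_sub (u v : TangentSpace I p) :
    hM.nablaNablaXi p u v - hM.nablaNablaXi p v u
      = (inner ℝ (ξ p) v : ℝ) • nullityOperator I φ ξ κ μ ν p u
        - (inner ℝ (ξ p) u : ℝ) • nullityOperator I φ ξ κ μ ν p v := by
  rw [← hM.curvature_xi, curvature_apply_field hM.smoothNear_xi]

/-- The structure equation `B² = 2αB + (κ + 2α²) φ²`. -/
theorem nablaXi_nablaXi (v : TangentSpace I p) :
    hM.nablaXi p (hM.nablaXi p v) = (2 * α) • hM.nablaXi p v
      - (κ p + 2 * α ^ 2) • (v - (inner ℝ (ξ p) v : ℝ) • ξ p) := by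
  refine (hM.reebAlgebra p).B_B (L := fun v ↦ hM.nablaNablaXi p (ξ p) v) (μ := μ p) (ν := ν p)
    (fun v ↦ ?_) (fun v ↦ ?_) v
  · have h1 := hM.nabla_anticommute (ξ p) v
    rw [hM.nablaPhi_xi_left, hM.nablaPhi_xi_left, map_zero, smul_zero, zero_add, add_zero,
      add_comm] at h1
    exact eq_neg_of_add_eq_zero_left h1
  · have h1 := hM.nablaNablaXi_sub v (ξ p)
    have h2 : nullityOperator I φ ξ κ μ ν p (ξ p) = κ p • ξ p := by
      rw [hM.nullityOperator_eq, hM.nablaXi_xi, hM.phi_xi, map_zero, smul_zero, sub_zero, map_zero,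
        smul_zero, smul_zero, add_zero, add_zero]
    rw [hM.nablaNablaXi_xi, hM.inner_xi, h2, one_smul, hM.nullityOperator_eq] at h1
    refine h1.trans ?_
    change _ = κ p • (v - _) + μ p • (φ p (hM.nablaXi p v) - α • φ p v)
      + ν p • φ p (φ p (hM.nablaXi p v) - α • φ p v)
    module

/-- As `dκ ∧ η = 0`, the function `κ` has vanishing derivative along `ker η`. -/
theorem mvfderiv_kappa {u : TangentSpace I p} (hu : (inner ℝ (ξ p) u : ℝ) = 0) :
    mvfderiv I κ p u = 0 := by
  have h1 := hM.kappa_mem.wedge_eq_zero p u (ξ p)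
  rwa [hM.eta_xi, hM.eta_eq, hu, mul_zero, sub_zero, mul_one] at h1

/-- The derivative of `B² = 2αB + (κ + 2α²) φ²` along a vector `u` of `ker η`. -/
theorem nablaNablaXi_nablaXi {u : TangentSpace I p} (hu : (inner ℝ (ξ p) u : ℝ) = 0)
    (v : TangentSpace I p) :
    hM.nablaNablaXi p u (hM.nablaXi p v) + hM.nablaXi p (hM.nablaNablaXi p u v)
        - (2 * α) • hM.nablaNablaXi p u v
      = (κ p + 2 * α ^ 2) • ((inner ℝ (hM.nablaXi p u) v : ℝ) • ξ p
        + (inner ℝ (ξ p) v : ℝ) • hM.nablaXi p u) := by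
  have hX := smoothNear_extendVector u
  have hY := smoothNear_extendVector v
  have hXp := extendVector_self (I := I) u
  have hYp := extendVector_self (I := I) v
  set X := extendVector I u
  set Y := extendVector I v
  have hξ := hM.smoothNear_xi p
  have hB := smoothEndNear_nablaField hM.smoothNear_xi p
  have hBY := hB Y hY
  have hκ : SmoothFunNear I (fun x ↦ κ x + 2 * α ^ 2) p :=
    SmoothFunNear.add (Filter.Eventually.of_forall fun x ↦ hM.kappa_mem.smooth x)
      (smoothFunNear_const _)
  have hf := hξ.inner_field hY
  have hW := hY.sub (hξ.smul hf)
  have h0 : mvfderiv I (fun x ↦ κ x + 2 * α ^ 2) p u = 0 := by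
    rw [mvfderiv_fun_add (hM.kappa_mem.smooth.mdifferentiable (by simp) p)
      (smoothFunNear_const (2 * α ^ 2)).mdifferentiableAt, mvfderiv_const]
    simpa using hM.mvfderiv_kappa hu
  have h1 : (fun x ↦ nablaField hM.smoothNear_xi x (nablaField hM.smoothNear_xi x (Y x)))
      = ((2 * α) • fun x ↦ nablaField hM.smoothNear_xi x (Y x))
        - (fun x ↦ κ x + 2 * α ^ 2) • (Y - (fun x ↦ (inner ℝ (ξ x) (Y x) : ℝ)) • ξ) :=
    funext fun x ↦ hM.nablaXi_nablaXi (Y x)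
  have h2 := hB.leviCivita_apply hX hBY
  rw [h1, leviCivita_sub_right hX (hBY.const_smul (2 * α)) (hW.smul hκ),
    leviCivita_const_smul_right _ hX hBY, leviCivita_smul_right hκ hX hW,
    leviCivita_sub_right hX hY (hξ.smul hf), leviCivita_smul_right hf hX hξ,
    hM.mvfderiv_inner_xi hX hY, hB.leviCivita_apply hX hY, map_add,
    ← nablaField_apply hM.smoothNear_xi hX, hXp, hYp, h0] at h2
  have h3 := hM.nablaXi_nablaXi (leviCivita I X Y p)
  change nablaField hM.smoothNear_xi p
    (nablaField hM.smoothNear_xi p (leviCivita I X Y p)) = _ at h3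
  rw [h3] at h2
  rw [← sub_eq_zero] at h2 ⊢
  rw [← neg_eq_zero, ← h2]
  module

theorem hasKaehlerLeavesAt (hp : Module.finrank ℝ E ≤ 3 ∨ κ p ≠ -α ^ 2) :
    hM.HasKaehlerLeavesAt p := by
  refine (hM.reebAlgebra p).nablaPhi_eq hM.inner_nablaPhi hM.nablaPhi_xi hM.nablaPhi_xi_left
    fun u v w hu hv hw ↦ ?_
  rcases hp with hp | hp
  · exact (hM.reebAlgebra p).inner_nablaPhi_eq_zero_of_finrank_le
      (F := hM.nablaPhi p) hp hM.inner_nablaPhi hM.nablaPhi_phi hv hw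
  · refine (hM.reebAlgebra p).inner_nablaPhi_eq_zero (F := hM.nablaPhi p)
      (D := hM.nablaNablaXi p) hp hM.nablaXi_nablaXi hM.inner_nablaPhi
      hM.nablaPhi_phi hM.cyclic_nablaPhi hM.nablaNablaXi_symm (fun u v hu hv ↦ ?_)
      hM.nabla_anticommute (fun u v w hu hv hw ↦ ?_) hu hv hw
    · have h1 := hM.nablaNablaXi_sub u v
      rw [hu, hv, zero_smul, zero_smul, sub_zero] at h1
      exact sub_eq_zero.1 h1
    · refine (congrArg (fun x ↦ (inner ℝ x w : ℝ)) (hM.nablaNablaXi_nablaXi hu v)).trans ?_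
      rw [hv, zero_smul, add_zero, real_inner_smul_left, real_inner_smul_left, hw, mul_zero,
        mul_zero]

theorem eventually_hasKaehlerLeavesAt (hp : Module.finrank ℝ E ≤ 3 ∨ κ p ≠ -α ^ 2) :
    ∀ᶠ x in 𝓝 p, hM.HasKaehlerLeavesAt x := by
  rcases hp with hp | hp
  · exact Filter.Eventually.of_forall fun x ↦ hM.hasKaehlerLeavesAt (Or.inl hp)
  · filter_upwards [hM.kappa_mem.smooth.continuous.continuousAt.eventually_ne hp] with x hx
    exact hM.hasKaehlerLeavesAt (Or.inr hx)

theorem ricciOperator_commutator {n : ℕ} (hn : Module.finrank ℝ E = 2 * n + 1)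
    (hp : n ≤ 1 ∨ κ p ≠ -α ^ 2) (v : TangentSpace I p) :
    ricciOperator I p (φ p v) - φ p (ricciOperator I p v)
      = (2 * μ p) • hTensor I φ ξ p (φ p v)
        + (2 * (2 * α * ((n : ℝ) - 1) + ν p)) • hTensor I φ ξ p v := by
  have hK := hM.eventually_hasKaehlerLeavesAt (p := p) (hp.imp_left fun h ↦ by omega)
  rw [hM.hTensor_eq, hM.hTensor_eq]
  let S : TangentSpace I p →ₗ[ℝ] TangentSpace I p :=
    (φ p).toLinearMap ∘ₗ hM.nablaXi p - α • (φ p).toLinearMap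
  exact (hM.reebAlgebra p).ricci_commutator (orthoFrame I p) hn (curvatureHom I p)
    (T := κ p • LinearMap.id + μ p • S + ν p • (φ p).toLinearMap ∘ₗ S)
    (fun _ ↦ rfl) curvature_swap curvature_bianchi inner_curvature
    (fun u v ↦ by
      refine (hM.curvature_xi u v).trans ?_
      rw [hM.nullityOperator_eq, hM.nullityOperator_eq]
      rfl)
    (IsAlmostContactMetric.curvature_phi hK) v

end IsKappaMuNuSpace

end KappaMuNu

end AlmostCosymplectic

end

theorem mainTheorem9 (n : ℕ) {M : Type*} [TopologicalSpace M] [T2Space M]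
    [SecondCountableTopology M] [ChartedSpace (EuclideanSpace ℝ (Fin (2 * n + 1))) M]
    [IsManifold (𝓡 (2 * n + 1)) ∞ M]
    [RiemannianBundle (fun x : M ↦ TangentSpace (𝓡 (2 * n + 1)) x)]
    [IsContMDiffRiemannianBundle (𝓡 (2 * n + 1)) ∞ (EuclideanSpace ℝ (Fin (2 * n + 1)))
      (fun x : M ↦ TangentSpace (𝓡 (2 * n + 1)) x)]
    (α : ℝ)
    (φ : Π x : M, TangentSpace (𝓡 (2 * n + 1)) x →L[ℝ] TangentSpace (𝓡 (2 * n + 1)) x)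
    (ξ : Π x : M, TangentSpace (𝓡 (2 * n + 1)) x)
    (η : Π x : M, TangentSpace (𝓡 (2 * n + 1)) x →L[ℝ] ℝ)
    (κ μ ν : M → ℝ)
    (hM : IsKappaMuNuSpace (𝓡 (2 * n + 1)) α φ ξ η κ μ ν)
    (p : M) (hp : n ≤ 1 ∨ κ p ≠ -α ^ 2)
    (v : TangentSpace (𝓡 (2 * n + 1)) p) :
    ricciOperator (𝓡 (2 * n + 1)) p (φ p v) - φ p (ricciOperator (𝓡 (2 * n + 1)) p v)
      = (2 * μ p) • hTensor (𝓡 (2 * n + 1)) φ ξ p (φ p v)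
        + (2 * (2 * α * ((n : ℝ) - 1) + ν p)) • hTensor (𝓡 (2 * n + 1)) φ ξ p v := by
  exact hM.ricciOperator_commutator (finrank_euclideanSpace_fin) hp v
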